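/- **Dimensions.** A dimension context $\Psi$ is a list of distinct variables $(i_1,\dots,i_n)$ or the inconsistent context $\bot$. Dimension terms over $(i_1,\dots,i_n)$ are the elements of the free De Morgan algebra on $i_1,\dots,i_n$; over $\bot$ all dimension terms are equal. They are *cartesian* if they are variables or $0,1$, *disjunctive* if built from these with $\vee$, *Dedekind* if built with $\vee,\wedge$, and *De Morgan* in general. Cartesian terms are also called atomic. Fix one of these four contortion theories. A contortion $\psi:\Psi'\rightsquigarrow\Psi$ assigns to each variable of $\Psi$ a dimension term over $\Psi'$ (a contortion to $\bot$ exists only from $\bot$, and is unique); a substitution is a contortion with atomic terms. For $r$ atomic over $\Psi$ and an endpoint $e\in\{0,1\}$, the constrained context $\Psi|_{r=e}$ is $\Psi$ without $r$ if $r$ is a variable, $\bot$ if $r=1-e$, and $\Psi$ otherwise; there is an evident substitution $(r=e):\Psi|_{r=e}\to\Psi$. **Cells.** A boundary over $\Psi;\Psi'$ is a finite list of entries $r=e\hookrightarrow t$ with $r$ atomic over $\Psi$ and $t$ a cell over $\Psi|_{r=e},\Psi'$ that agrees with the previous entries where the constraints overlap. A cell $t$ over $\Psi$ agrees with a boundary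 $\phi$ over $\Psi$ if $t[(r=e)]=t'$ for every entry $r=e\hookrightarrow t'$ of $\phi$. A cell context $\Gamma$ is a list of distinct declared cell variables $a:\Psi[\phi]$, where $\phi$ is a boundary over $\Psi$ consisting of contorted cells over the preceding part of $\Gamma$. Contorted cells over $\Psi$ are $a(\psi)$ with $(a:\Psi'[\phi])\in\Gamma$ and $\psi:\Psi\rightsquigarrow\Psi'$ in the chosen contortion theory; their equality is generated by $a(\psi)=t\langle\psi\rangle$ whenever $(r=e\hookrightarrow t)\in\phi$ and $r\langle\psi\rangle=e$, all cells over $\bot$ being equal. Kan cells over $\Gamma;\Psi$ are generated from contorted cells (closed under substitution) by the operation $\mathsf{fill}^{e\to r}i.[\phi]\,u$, where $e$ is an endpoint, $r$ is atomic over $\Psi$, $\phi$ is a boundary of Kan cells over $\Psi;i$, and $u$ is a Kan cell over $\Psi$ that agrees with $\phi[i\mapsto e]$; their equality is the congruence, compatible with substitution, generated by equality of contorted cells, by the requirement that $\mathsf{fill}^{e\to r}i.[\phi]\,u$ agrees with $\phi[i\mapsto r]$ and with the entry $r=e\hookrightarrow u$, and by the equality of all Kan cells over $\bot$. **Presentations.**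 Let $\langle X\mid R\rangle$ be a convenient presentation of a group $G$: $X$ is finite, the inverse in $G$ of every generator is again represented by a generator, and $R$ is a finite set of equations, each of the form $abc^{-1}=1$ with $a,b,c\in X$. Let $\Gamma_{X|R}$ be the cell context consisting of a point $\star$; a loop $\hat a:(i)[i=0\hookrightarrow\star,\ i=1\hookrightarrow\star]$ for each $a\in X$; and, for each equation $abc^{-1}=1$ in $R$, a square $$s_{a,b,c}:(j,k)[k=0\hookrightarrow\hat a(j),\ k=1\hookrightarrow\hat c(j),\ j=0\hookrightarrow\star,\ j=1\hookrightarrow\hat b(k)].$$ For a Kan cell $t$ over $(i)$ with both endpoints $\star$, $a\in X$ and $e\in\{0,1\}$, put $$t\rhd^e a:=\mathsf{fill}^{(1-e)\to e}j.[i=0\hookrightarrow\star,\ i=1\hookrightarrow\hat a(j)]\,t .$$ Encode words in the letters $x,x^{-1}$ $(x\in X)$ as paths over $(i)$ by $\underline{\varepsilon}=\star$, $\underline{wa}=\underline w\rhd^1a$, $\underline{wa^{-1}}=\underline w\rhd^0a$. **Statement.** For each of the four contortion theories and any words $v,w$ on $X$, there exists a Kan cell $t$ over $\Gamma_{X|R};(i,k)$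 that agrees with the Kan boundary $$[\,i=0\hookrightarrow\star,\ i=1\hookrightarrow\star,\ k=0\hookrightarrow\underline v(i),\ k=1\hookrightarrow\underline w(i)\,]$$ if and only if $v$ and $w$ represent the same element of $G$. -/

import Mathlib

universe u

namespace CubicalKan

/-! ### Dimensions -/

/-- Dimension contexts: a list of `n` dimension variables, or the inconsistent context `⊥`.
Variables are represented by their position in the list. -/
inductive DimCtx : Type
  | vars (n : ℕ)
  | bot

namespace DimCtx

/-- The variables of a dimension context. -/
abbrev Var : DimCtx → Type
  | vars n => Fin n
  | bot => Empty

/-- The extension `Ψ, i` by one fresh (last) variable. -/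
abbrev ext : DimCtx → DimCtx
  | vars n => vars (n + 1)
  | bot => bot

/-- The extension of a dimension context by `m` fresh variables. -/
abbrev extBy (Ψ : DimCtx) : ℕ → DimCtx
  | 0 => Ψ
  | m + 1 => (extBy Ψ m).ext

end DimCtx

/-- Atomic dimension terms: variables and the endpoints `0 = false`, `1 = true`. -/
inductive Atom (Ψ : DimCtx) : Type
  | var (i : Ψ.Var)
  | const (b : Bool)

/-- Raw dimension terms; they are considered up to `DimEq`. -/
inductive DimTerm (Ψ : DimCtx) : Type
  | var (i : Ψ.Var)
  | const (b : Bool)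
  | neg (r : DimTerm Ψ)
  | sup (r s : DimTerm Ψ)
  | inf (r s : DimTerm Ψ)

/-- Equality of dimension terms: the laws of De Morgan algebras; over `⊥` all terms are equal. -/
inductive DimEq {Ψ : DimCtx} : DimTerm Ψ → DimTerm Ψ → Prop
  | refl (r) : DimEq r r
  | symm {r s} : DimEq r s → DimEq s r
  | trans {r s t} : DimEq r s → DimEq s t → DimEq r t
  | neg_congr {r r'} : DimEq r r' → DimEq (.neg r) (.neg r')
  | sup_congr {r r' s s'} : DimEq r r' → DimEq s s' → DimEq (.sup r s) (.sup r' s')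
  | inf_congr {r r' s s'} : DimEq r r' → DimEq s s' → DimEq (.inf r s) (.inf r' s')
  | neg_const (b) : DimEq (.neg (.const b)) (.const (!b))
  | neg_neg (r) : DimEq (.neg (.neg r)) r
  | sup_comm (r s) : DimEq (.sup r s) (.sup s r)
  | sup_assoc (r s t) : DimEq (.sup (.sup r s) t) (.sup r (.sup s t))
  | sup_zero (r) : DimEq (.sup r (.const false)) r
  | sup_one (r) : DimEq (.sup r (.const true)) (.const true)
  | sup_idem (r) : DimEq (.sup r r) r
  | distrib (r s t) : DimEq (.inf r (.sup s t)) (.sup (.inf r s) (.inf r t))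
  | neg_sup (r s) : DimEq (.neg (.sup r s)) (.inf (.neg r) (.neg s))
  | neg_inf (r s) : DimEq (.neg (.inf r s)) (.sup (.neg r) (.neg s))
  | bot (h : Ψ = .bot) (r s) : DimEq r s

/-- The four contortion theories. -/
inductive ContortionTheory : Type
  | cartesian
  | disjunctive
  | dedekind
  | deMorgan

/-- The dimension terms that belong to the sublanguage of a contortion theory. -/
def DimTerm.InLang {Ψ : DimCtx} (T : ContortionTheory) : DimTerm Ψ → Prop
  | .var _ => True
  | .const _ => True
  | .neg r => T = .deMorgan ∧ r.InLang T
  | .sup r s => T ≠ .cartesian ∧ r.InLang T ∧ s.InLang T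
  | .inf r s => (T = .dedekind ∨ T = .deMorgan) ∧ r.InLang T ∧ s.InLang T

/-- An atomic term, regarded as a dimension term. -/
def Atom.toTerm {Ψ : DimCtx} : Atom Ψ → DimTerm Ψ
  | .var i => .var i
  | .const b => .const b

/-- Contortions `ψ : Ψ' ⇝ Ψ`: a dimension term over `Ψ'` for each variable of `Ψ`. There is a
(unique) contortion to `⊥` only from `⊥`. -/
@[ext] structure Contortion (Ψ' Ψ : DimCtx) : Type where
  toFun : Ψ.Var → DimTerm Ψ'
  bot_of_bot : Ψ = .bot → Ψ' = .bot

/-- Substitutions `σ : Ψ' → Ψ`: contortions all of whose terms are atomic. -/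
@[ext] structure Subst (Ψ' Ψ : DimCtx) : Type where
  toFun : Ψ.Var → Atom Ψ'
  bot_of_bot : Ψ = .bot → Ψ' = .bot

/-- All terms of the contortion belong to the given contortion theory. -/
def Contortion.InLang {Ψ' Ψ : DimCtx} (T : ContortionTheory) (ψ : Contortion Ψ' Ψ) : Prop :=
  ∀ i, (ψ.toFun i).InLang T

/-- A substitution, regarded as a contortion. -/
def Subst.toContortion {Ψ' Ψ : DimCtx} (σ : Subst Ψ' Ψ) : Contortion Ψ' Ψ :=
  ⟨fun i => (σ.toFun i).toTerm, σ.bot_of_bot⟩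

/-- Action of a substitution on atomic terms. -/
def Atom.sub {Ψ' Ψ : DimCtx} : Atom Ψ → Subst Ψ' Ψ → Atom Ψ'
  | .var i, σ => σ.toFun i
  | .const b, _ => .const b

/-- Action of a contortion on dimension terms. -/
def DimTerm.act {Ψ' Ψ : DimCtx} : DimTerm Ψ → Contortion Ψ' Ψ → DimTerm Ψ'
  | .var i, ψ => ψ.toFun i
  | .const b, _ => .const b
  | .neg r, ψ => .neg (r.act ψ)
  | .sup r s, ψ => .sup (r.act ψ) (s.act ψ)
  | .inf r s, ψ => .inf (r.act ψ) (s.act ψ)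

/-- Composition of contortions. -/
def Contortion.comp {Ψ'' Ψ' Ψ : DimCtx} (ψ : Contortion Ψ' Ψ) (ψ' : Contortion Ψ'' Ψ') :
    Contortion Ψ'' Ψ :=
  ⟨fun i => (ψ.toFun i).act ψ', fun h => ψ'.bot_of_bot (ψ.bot_of_bot h)⟩

/-- Composition of substitutions. -/
def Subst.comp {Ψ'' Ψ' Ψ : DimCtx} (σ : Subst Ψ' Ψ) (τ : Subst Ψ'' Ψ') : Subst Ψ'' Ψ :=
  ⟨fun i => (σ.toFun i).sub τ, fun h => τ.bot_of_bot (σ.bot_of_bot h)⟩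

/-- The identity substitution. -/
def Subst.id (Ψ : DimCtx) : Subst Ψ Ψ := ⟨fun i => .var i, fun h => h⟩

/-- The weakening substitution `(Ψ, i) → Ψ`. -/
def Subst.wk : (Ψ : DimCtx) → Subst Ψ.ext Ψ
  | .vars _ => ⟨fun i => .var (Fin.castSucc i), fun h => DimCtx.noConfusion h⟩
  | .bot => Subst.id .bot

/-- The fresh variable `i` of `Ψ, i`, as an atomic term (over `⊥`, all atomic terms are equal). -/
def newVar : (Ψ : DimCtx) → Atom Ψ.ext
  | .vars n => .var (Fin.last n)
  | .bot => .const false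

/-- The substitution `(σ, i ↦ r) : Ψ' → (Ψ, i)`. -/
def Subst.snoc {Ψ' : DimCtx} : {Ψ : DimCtx} → Subst Ψ' Ψ → Atom Ψ' → Subst Ψ' Ψ.ext
  | .vars n, σ, r =>
      ⟨fun i : Fin (n + 1) => Fin.lastCases (motive := fun _ => Atom Ψ') r (fun j => σ.toFun j) i,
        fun h => DimCtx.noConfusion h⟩
  | .bot, σ, _ => σ

/-- The substitution `(i ↦ r) : Ψ → (Ψ, i)`. -/
def Subst.inst {Ψ : DimCtx} (r : Atom Ψ) : Subst Ψ Ψ.ext := (Subst.id Ψ).snoc r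

/-- The substitution `Ψ → (Ψ, Ψ')` that sends each of the `m` variables of `Ψ'` to `r`. -/
def Subst.instBy {Ψ : DimCtx} (r : Atom Ψ) : (m : ℕ) → Subst Ψ (Ψ.extBy m)
  | 0 => Subst.id Ψ
  | m + 1 => (Subst.instBy r m).snoc r

/-- The extension `(σ, i ↦ i) : (Ψ', i) → (Ψ, i)`. -/
def Subst.ext1 {Ψ' Ψ : DimCtx} (σ : Subst Ψ' Ψ) : Subst Ψ'.ext Ψ.ext :=
  (σ.comp (Subst.wk Ψ')).snoc (newVar Ψ')

/-- The extension of a substitution by `m` fresh variables. -/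
def Subst.extBy {Ψ' Ψ : DimCtx} (σ : Subst Ψ' Ψ) : (m : ℕ) → Subst (Ψ'.extBy m) (Ψ.extBy m)
  | 0 => σ
  | m + 1 => (σ.extBy m).ext1

/-! ### Constrained dimension contexts -/

/-- `Ψ` if the flag is true and `⊥` otherwise. -/
abbrev DimCtx.guard (Ψ : DimCtx) : Bool → DimCtx
  | true => Ψ
  | false => .bot

/-- The context `Ψ` with one variable removed (only used for contexts that have a variable). -/
abbrev DimCtx.drop : DimCtx → DimCtx
  | .vars (n + 1) => .vars n
  | .vars 0 => .vars 0
  | .bot => .bot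

/-- The constrained dimension context `Ψ|(r = e)`. -/
abbrev DimCtx.con (Ψ : DimCtx) : Atom Ψ → Bool → DimCtx
  | .var _, _ => Ψ.drop
  | .const b, e => Ψ.guard (b == e)

/-- Each variable of `Ψ.guard p` is a variable of `Ψ`. -/
def guardVar {Ψ : DimCtx} : (p : Bool) → (Ψ.guard p).Var → Ψ.Var
  | true, j => j
  | false, j => Empty.elim j

/-- The variables of `Ψ.drop` are the variables of `Ψ` other than `i`, in the same order. -/
def dropVar : {Ψ : DimCtx} → (i : Ψ.Var) → Ψ.drop.Var → Ψ.Var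
  | .vars (n + 1), i, j => Fin.succAbove (n := n) i j
  | .vars 0, i, _ => Fin.elim0 i
  | .bot, i, _ => Empty.elim i

/-- Each variable of `Ψ|(r = e)` is a variable of `Ψ`. -/
def conVar {Ψ : DimCtx} : (r : Atom Ψ) → (e : Bool) → (Ψ.con r e).Var → Ψ.Var
  | .var i, _, j => dropVar i j
  | .const b, e, j => guardVar (b == e) j

/-- The substitution `Ψ.guard p → Ψ`: the identity, or the unique substitution from `⊥`. -/
def guardSub {Ψ : DimCtx} : (p : Bool) → Subst (Ψ.guard p) Ψ
  | true => Subst.id Ψ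
  | false => ⟨fun _ => .const false, fun _ => rfl⟩

/-- The substitution `Ψ.drop → Ψ` that sends `i` to `e` and every other variable to itself. -/
def dropSub : {Ψ : DimCtx} → (i : Ψ.Var) → (e : Bool) → Subst Ψ.drop Ψ
  | .vars (n + 1), i, e =>
      ⟨Fin.insertNth (n := n) (α := fun _ => Atom (.vars n)) i (.const e) (fun j => .var j),
        fun h => DimCtx.noConfusion h⟩
  | .vars 0, i, _ => Fin.elim0 i
  | .bot, i, _ => Empty.elim i

/-- The constraining substitution `(r = e) : Ψ|(r = e) → Ψ`. -/
def inclcon {Ψ : DimCtx} : (r : Atom Ψ) → (e : Bool) → Subst (Ψ.con r e) Ψ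
  | .var i, e => dropSub i e
  | .const b, e => guardSub (b == e)

theorem con_bot (r : Atom .bot) (e : Bool) : DimCtx.con .bot r e = .bot := by
  cases r with
  | var i => exact Empty.elim i
  | const b => cases b <;> cases e <;> rfl

theorem con_sub_eq_bot {Ψ' Ψ : DimCtx} (σ : Subst Ψ' Ψ) (r : Atom Ψ) (e : Bool)
    (h : Ψ.con r e = .bot) : Ψ'.con (r.sub σ) e = .bot := by
  cases Ψ with
  | bot =>
    obtain rfl := σ.bot_of_bot rfl
    exact con_bot _ e
  | vars n =>
    cases r with
    | var i =>
      cases n with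
      | zero => exact Fin.elim0 i
      | succ n => exact DimCtx.noConfusion h
    | const b => cases b <;> cases e <;> first | rfl | exact DimCtx.noConfusion h

/-- The substitution `σ|(r = e) : Ψ'|(r[σ] = e) → Ψ|(r = e)` induced by `σ : Ψ' → Ψ`. -/
def Subst.con {Ψ' Ψ : DimCtx} (σ : Subst Ψ' Ψ) (r : Atom Ψ) (e : Bool) :
    Subst (Ψ'.con (r.sub σ) e) (Ψ.con r e) :=
  ⟨fun j => (σ.toFun (conVar r e j)).sub (inclcon (r.sub σ) e), con_sub_eq_bot σ r e⟩

/-! ### Contorted cells and cell contexts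

`V` is the type of names of cell variables. -/

/-- Raw contorted cells `a(ψ)`, with `ψ : Ψ ⇝ dim` where `dim` is the dimension context of `a`. -/
structure CCell (V : Type u) (Ψ : DimCtx) : Type u where
  name : V
  dim : DimCtx
  arg : Contortion Ψ dim

/-- Action of contortions on contorted cells. -/
def CCell.act {V : Type u} {Ψ' Ψ : DimCtx} (c : CCell V Ψ) (ψ : Contortion Ψ' Ψ) : CCell V Ψ' :=
  ⟨c.name, c.dim, c.arg.comp ψ⟩

/-- Action of substitutions on contorted cells. -/
def CCell.sub {V : Type u} {Ψ' Ψ : DimCtx} (c : CCell V Ψ) (σ : Subst Ψ' Ψ) : CCell V Ψ' :=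
  c.act σ.toContortion

/-- Raw contorted boundaries over `Ψ`: lists of entries `r = e ↪ t` with `r` atomic over `Ψ` and
`t` a contorted cell over `Ψ|(r = e)`. -/
inductive CBdy (V : Type u) (Ψ : DimCtx) : Type u
  | nil : CBdy V Ψ
  | snoc (φ : CBdy V Ψ) (r : Atom Ψ) (e : Bool) (t : CCell V (Ψ.con r e)) : CBdy V Ψ

/-- `φ.Mem r e t`: the boundary `φ` contains the entry `r = e ↪ t`. -/
inductive CBdy.Mem {V : Type u} {Ψ : DimCtx} :
    CBdy V Ψ → (r : Atom Ψ) → (e : Bool) → CCell V (Ψ.con r e) → Prop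
  | here {φ r e t} : CBdy.Mem (.snoc φ r e t) r e t
  | there {φ r e t r' e' t'} : CBdy.Mem φ r e t → CBdy.Mem (.snoc φ r' e' t') r e t

/-- Action of a substitution on a contorted boundary. -/
def CBdy.sub {V : Type u} {Ψ' Ψ : DimCtx} : CBdy V Ψ → Subst Ψ' Ψ → CBdy V Ψ'
  | .nil, _ => .nil
  | .snoc φ r e t, σ => .snoc (φ.sub σ) (r.sub σ) e (t.sub (σ.con r e))

/-- Declarations `a : Ψ[φ]`. -/
structure Decl (V : Type u) : Type u where
  name : V
  dim : DimCtx
  bdy : CBdy V dim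

/-- Raw cell contexts; the most recent declaration comes first. -/
abbrev Ctx (V : Type u) : Type u := List (Decl V)

section Contorted

variable {V : Type u} (T : ContortionTheory) (Γ : Ctx V)

/-- The judgment that `c` is a contorted cell over `Γ; Ψ`, in the contortion theory `T`. -/
def IsCCell {Ψ : DimCtx} (c : CCell V Ψ) : Prop :=
  (∃ φ, (⟨c.name, c.dim, φ⟩ : Decl V) ∈ Γ) ∧ c.arg.InLang T

/-- Equality of contorted cells. In `bdy`, `ψ₀` is the restriction of `ψ` to the variables of the
constrained context, over which `t` lives. -/
inductive CEq : {Ψ : DimCtx} → CCell V Ψ → CCell V Ψ → Prop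
  | refl {Ψ : DimCtx} {c : CCell V Ψ} : IsCCell T Γ c → CEq c c
  | symm {Ψ : DimCtx} {c c' : CCell V Ψ} : CEq c c' → CEq c' c
  | trans {Ψ : DimCtx} {c c' c'' : CCell V Ψ} : CEq c c' → CEq c' c'' → CEq c c''
  | dim {Ψ Ψ₀ : DimCtx} {a : V} {ψ ψ' : Contortion Ψ Ψ₀} :
      IsCCell T Γ ⟨a, Ψ₀, ψ⟩ → IsCCell T Γ ⟨a, Ψ₀, ψ'⟩ →
      (∀ i, DimEq (ψ.toFun i) (ψ'.toFun i)) → CEq ⟨a, Ψ₀, ψ⟩ ⟨a, Ψ₀, ψ'⟩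
  | bot {c c' : CCell V .bot} : IsCCell T Γ c → IsCCell T Γ c' → CEq c c'
  | bdy {Ψ : DimCtx} {d : Decl V} {r : Atom d.dim} {e : Bool} {t : CCell V (d.dim.con r e)}
      {ψ : Contortion Ψ d.dim} {ψ₀ : Contortion Ψ (d.dim.con r e)} :
      d ∈ Γ → d.bdy.Mem r e t → ψ.InLang T → DimEq (r.toTerm.act ψ) (.const e) →
      (∀ j, ψ₀.toFun j = ψ.toFun (conVar r e j)) →
      CEq ⟨d.name, d.dim, ψ⟩ (t.act ψ₀)

/-- The judgment that `φ` is a contorted boundary over `Γ; Ψ`: every entry is a contorted cell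
that agrees with the previous entries. -/
inductive IsCBdy {Ψ : DimCtx} : CBdy V Ψ → Prop
  | nil : IsCBdy .nil
  | snoc {φ : CBdy V Ψ} {r : Atom Ψ} {e : Bool} {t : CCell V (Ψ.con r e)} :
      IsCBdy φ → IsCCell T Γ t →
      (∀ s e' t', (φ.sub (inclcon r e)).Mem s e' t' →
        CEq T Γ (t.sub (inclcon s e')) t') →
      IsCBdy (.snoc φ r e t)

end Contorted

/-- The judgment that `Γ` is a cell context. -/
inductive IsCtx {V : Type u} (T : ContortionTheory) : Ctx V → Prop
  | nil : IsCtx T []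
  | cons {Γ : Ctx V} {d : Decl V} :
      IsCtx T Γ → (∀ d' ∈ Γ, d'.name ≠ d.name) → IsCBdy T Γ d.bdy → IsCtx T (d :: Γ)

/-! ### Kan cells -/

mutual

/-- Raw Kan cells, with explicit substitutions. In `fill e r φ u`, the boundary `φ` lives over
`Ψ; i` with `i` the bound variable. -/
inductive Tm (V : Type u) : DimCtx → Type u
  | cont {Ψ : DimCtx} (c : CCell V Ψ) : Tm V Ψ
  | sub {Ψ' Ψ : DimCtx} (t : Tm V Ψ) (σ : Subst Ψ' Ψ) : Tm V Ψ'
  | fill {Ψ : DimCtx} (e : Bool) (r : Atom Ψ) (φ : KBdy V 1 Ψ) (u : Tm V Ψ) : Tm V Ψ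

/-- Raw Kan boundaries over `Ψ; Ψ'` with `Ψ'` a list of `m` variables: lists of entries `r = e ↪ t`
with `r` atomic over `Ψ` and `t` a Kan cell over `Ψ|(r = e), Ψ'`. -/
inductive KBdy (V : Type u) : ℕ → DimCtx → Type u
  | nil {m : ℕ} {Ψ : DimCtx} : KBdy V m Ψ
  | snoc {m : ℕ} {Ψ : DimCtx} (φ : KBdy V m Ψ) (r : Atom Ψ) (e : Bool)
      (t : Tm V ((Ψ.con r e).extBy m)) : KBdy V m Ψ

end

namespace KBdy

/-- `φ.Mem r e t`: the boundary `φ` contains the entry `r = e ↪ t`. -/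
inductive Mem {V : Type u} {m : ℕ} {Ψ : DimCtx} :
    KBdy V m Ψ → (r : Atom Ψ) → (e : Bool) → Tm V ((Ψ.con r e).extBy m) → Prop
  | here {φ r e t} : Mem (.snoc φ r e t) r e t
  | there {φ r e t r' e' t'} : Mem φ r e t → Mem (.snoc φ r' e' t') r e t

/-- Action of a substitution `σ : Ψ' → Ψ` on a boundary. -/
def sub {V : Type u} {m : ℕ} {Ψ' Ψ : DimCtx} : KBdy V m Ψ → Subst Ψ' Ψ → KBdy V m Ψ'
  | .nil, _ => .nil
  | .snoc φ r e t, σ => .snoc (φ.sub σ) (r.sub σ) e (t.sub ((σ.con r e).extBy m))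

/-- For a boundary `φ` over `Ψ; Ψ'` and `r` over `Ψ`, the boundary over `Ψ` in which all variables
of `Ψ'` are replaced by `r`. For `Ψ' = (i)` this is `φ[i ↦ r]`. -/
def inst {V : Type u} {m : ℕ} {Ψ : DimCtx} : KBdy V m Ψ → Atom Ψ → KBdy V 0 Ψ
  | .nil, _ => .nil
  | .snoc φ s e t, r => .snoc (φ.inst r) s e (t.sub (Subst.instBy (r.sub (inclcon s e)) m))

end KBdy

section Kan

variable {V : Type u} (T : ContortionTheory) (Γ : Ctx V)

mutual

/-- The judgment that `t` is a Kan cell over `Γ; Ψ`. -/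
inductive IsKan : {Ψ : DimCtx} → Tm V Ψ → Prop
  | cont {Ψ : DimCtx} {c : CCell V Ψ} : IsCCell T Γ c → IsKan (.cont c)
  | sub {Ψ' Ψ : DimCtx} {t : Tm V Ψ} {σ : Subst Ψ' Ψ} : IsKan t → IsKan (.sub t σ)
  | fill {Ψ : DimCtx} {e : Bool} {r : Atom Ψ} {φ : KBdy V 1 Ψ} {u : Tm V Ψ} :
      IsKanBdy φ → IsKan u →
      (∀ s e' t, (φ.inst (.const e)).Mem s e' t → KanEq (u.sub (inclcon s e')) t) →
      IsKan (.fill e r φ u)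

/-- The judgment that `φ` is a Kan boundary over `Γ; Ψ; Ψ'`, with `Ψ'` of length `m`: every entry
is a Kan cell that agrees with the previous entries. -/
inductive IsKanBdy : {m : ℕ} → {Ψ : DimCtx} → KBdy V m Ψ → Prop
  | nil {m : ℕ} {Ψ : DimCtx} : IsKanBdy (.nil : KBdy V m Ψ)
  | snoc {m : ℕ} {Ψ : DimCtx} {φ : KBdy V m Ψ} {r : Atom Ψ} {e : Bool}
      {t : Tm V ((Ψ.con r e).extBy m)} :
      IsKanBdy φ → IsKan t →
      (∀ s e' t', (φ.sub (inclcon r e)).Mem s e' t' →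
        KanEq (t.sub ((inclcon s e').extBy m)) t') →
      IsKanBdy (.snoc φ r e t)

/-- Equality of Kan cells. -/
inductive KanEq : {Ψ : DimCtx} → Tm V Ψ → Tm V Ψ → Prop
  | refl {Ψ : DimCtx} {t : Tm V Ψ} : IsKan t → KanEq t t
  | symm {Ψ : DimCtx} {t t' : Tm V Ψ} : KanEq t t' → KanEq t' t
  | trans {Ψ : DimCtx} {t t' t'' : Tm V Ψ} : KanEq t t' → KanEq t' t'' → KanEq t t''
  | bot {t t' : Tm V .bot} : IsKan t → IsKan t' → KanEq t t'
  | cont {Ψ : DimCtx} {c c' : CCell V Ψ} : CEq T Γ c c' → KanEq (.cont c) (.cont c')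
  | sub_congr {Ψ' Ψ : DimCtx} {t t' : Tm V Ψ} {σ : Subst Ψ' Ψ} :
      KanEq t t' → KanEq (.sub t σ) (.sub t' σ)
  | fill_congr {Ψ : DimCtx} {e : Bool} {r : Atom Ψ} {φ φ' : KBdy V 1 Ψ} {u u' : Tm V Ψ} :
      IsKan (.fill e r φ u) → IsKan (.fill e r φ' u') → KanBdyEq φ φ' → KanEq u u' →
      KanEq (.fill e r φ u) (.fill e r φ' u')
  | sub_id {Ψ : DimCtx} {t : Tm V Ψ} : IsKan t → KanEq (.sub t (Subst.id Ψ)) t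
  | sub_comp {Ψ'' Ψ' Ψ : DimCtx} {t : Tm V Ψ} {σ : Subst Ψ' Ψ} {τ : Subst Ψ'' Ψ'} :
      IsKan t → KanEq (.sub (.sub t σ) τ) (.sub t (σ.comp τ))
  | sub_cont {Ψ' Ψ : DimCtx} {c : CCell V Ψ} {σ : Subst Ψ' Ψ} :
      IsCCell T Γ c → KanEq (.sub (.cont c) σ) (.cont (c.sub σ))
  | sub_fill {Ψ' Ψ : DimCtx} {e : Bool} {r : Atom Ψ} {φ : KBdy V 1 Ψ} {u : Tm V Ψ}
      {σ : Subst Ψ' Ψ} :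
      IsKan (.fill e r φ u) →
      KanEq (.sub (.fill e r φ u) σ) (.fill e (r.sub σ) (φ.sub σ) (.sub u σ))
  /-- The filler has boundary `φ[i ↦ r]`. -/
  | fill_side {Ψ : DimCtx} {e : Bool} {r : Atom Ψ} {φ : KBdy V 1 Ψ} {u : Tm V Ψ}
      {s : Atom Ψ} {e' : Bool} {t : Tm V (Ψ.con s e')} :
      IsKan (.fill e r φ u) → (φ.inst r).Mem s e' t →
      KanEq (.sub (.fill e r φ u) (inclcon s e')) t
  /-- The filler has the boundary entry `r = e ↪ u`. -/
  | fill_base {Ψ : DimCtx} {e : Bool} {r : Atom Ψ} {φ : KBdy V 1 Ψ} {u : Tm V Ψ} :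
      IsKan (.fill e r φ u) →
      KanEq (.sub (.fill e r φ u) (inclcon r e)) (.sub u (inclcon r e))

/-- Entrywise equality of boundaries with the same constraints. -/
inductive KanBdyEq : {m : ℕ} → {Ψ : DimCtx} → KBdy V m Ψ → KBdy V m Ψ → Prop
  | nil {m : ℕ} {Ψ : DimCtx} : KanBdyEq (.nil : KBdy V m Ψ) .nil
  | snoc {m : ℕ} {Ψ : DimCtx} {φ φ' : KBdy V m Ψ} {r : Atom Ψ} {e : Bool}
      {t t' : Tm V ((Ψ.con r e).extBy m)} :
      KanBdyEq φ φ' → KanEq t t' → KanBdyEq (.snoc φ r e t) (.snoc φ' r e t')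

end

/-- The judgment `Γ; Ψ ⊢ t ⟨φ⟩`: the cell `t` is a Kan cell that agrees with the Kan boundary `φ`.
Its presuppositions, that `Γ` is a cell context and `φ` a Kan boundary, are included. -/
structure HasKanBdy {Ψ : DimCtx} (t : Tm V Ψ) (φ : KBdy V 0 Ψ) : Prop where
  isCtx : IsCtx T Γ
  isBdy : IsKanBdy T Γ φ
  isKan : IsKan T Γ t
  agrees : ∀ r e t', φ.Mem r e t' → KanEq T Γ (t.sub (inclcon r e)) t'

end Kan

/-! ### Group presentations -/

/-- Words on `X`: lists of letters `x` (written `(x, true)`) and `x⁻¹` (written `(x, false)`). -/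
abbrev Word (X : Type u) : Type u := List (X × Bool)

/-- A group presentation with set of generators `X` and a finite set of words `w`, each standing
for the equation `w = 1`. -/
structure GroupPresentation (X : Type u) : Type u where
  rels : Finset (Word X)

namespace GroupPresentation

variable {X : Type u} (P : GroupPresentation X)

/-- The group presented by `P`. -/
abbrev G : Type u := PresentedGroup {g : FreeGroup X | ∃ w ∈ P.rels, g = FreeGroup.mk w}

/-- The element of the presented group that a word represents. -/
def eval (w : Word X) : P.G := PresentedGroup.mk _ (FreeGroup.mk w)

/-- The word `a b c⁻¹`. -/
def triangle (a b c : X) : Word X := [(a, true), (b, true), (c, false)]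

/-- Convenient presentations: the inverse of each generator is a generator, and every equation has
the form `a b c⁻¹ = 1` with generators `a`, `b`, `c`. -/
structure IsConvenient : Prop where
  inv_closed : ∀ a : X, ∃ b : X, P.eval [(b, true)] = (P.eval [(a, true)])⁻¹
  rels_triangle : ∀ w ∈ P.rels, ∃ a b c : X, w = triangle a b c

end GroupPresentation

/-- Names of the cell variables of the context that encodes a presentation. -/
inductive CellName (X : Type u) : Type u
  | star
  | gen (a : X)
  | sq (a b c : X)

section Encoding

variable {X : Type u}

/-- The contorted cell `⋆` over a dimension context `Ψ`. -/
def starC (Ψ : DimCtx) : CCell (CellName X) Ψ :=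
  ⟨.star, .vars 0, fun i => Fin.elim0 i, fun h => DimCtx.noConfusion h⟩

/-- The contorted cell `â(r)`. -/
def genC {Ψ : DimCtx} (a : X) (r : DimTerm Ψ) : CCell (CellName X) Ψ :=
  ⟨.gen a, .vars 1, fun _ => r, fun h => DimCtx.noConfusion h⟩

/-- The declaration of the point `⋆`. -/
def starDecl : Decl (CellName X) := ⟨.star, .vars 0, .nil⟩

/-- The declaration of the loop `â : (i)[i = 0 ↪ ⋆, i = 1 ↪ ⋆]`. -/
def genDecl (a : X) : Decl (CellName X) :=
  ⟨.gen a, .vars 1,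
    .snoc (.snoc .nil (.var (0 : Fin 1)) false (starC (.vars 0)))
      (.var (0 : Fin 1)) true (starC (.vars 0))⟩

/-- The declaration of the square
`s_{a,b,c} : (j,k)[k = 0 ↪ â(j), k = 1 ↪ ĉ(j), j = 0 ↪ ⋆, j = 1 ↪ b̂(k)]`.
Each face lives over the one remaining variable. -/
def sqDecl (a b c : X) : Decl (CellName X) :=
  ⟨.sq a b c, .vars 2,
    .snoc (.snoc (.snoc (.snoc .nil
      (.var (1 : Fin 2)) false (genC (Ψ := .vars 1) a (.var (0 : Fin 1))))
      (.var (1 : Fin 2)) true (genC (Ψ := .vars 1) c (.var (0 : Fin 1))))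
      (.var (0 : Fin 2)) false (starC (.vars 1)))
      (.var (0 : Fin 2)) true (genC (Ψ := .vars 1) b (.var (0 : Fin 1)))⟩

open Classical in
/-- The triples `(a, b, c)` for which `a b c⁻¹ = 1` is an equation of the presentation. -/
noncomputable def GroupPresentation.triples [Fintype X] (P : GroupPresentation X) :
    List (X × X × X) :=
  (Finset.univ.filter fun p : X × X × X =>
    GroupPresentation.triangle p.1 p.2.1 p.2.2 ∈ P.rels).toList

/-- The cell context of a presentation: the point `⋆`, a loop for each generator and a square for
each equation. -/
noncomputable def GroupPresentation.ctx [Fintype X] (P : GroupPresentation X) :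
    Ctx (CellName X) :=
  P.triples.map (fun p => sqDecl p.1 p.2.1 p.2.2) ++
    ((Finset.univ : Finset X).toList.map genDecl ++ [starDecl])

/-- For `t` over `(i)`, the cell over `(i, ℓ)` given by
`fill^{ē → ℓ} j. [i = 0 ↪ ⋆, i = 1 ↪ â(j)] t`, where `ē` is the endpoint opposite to `e`. -/
def appendFill (e : Bool) (a : X) (t : Tm (CellName X) (.vars 1)) : Tm (CellName X) (.vars 2) :=
  .fill (Ψ := .vars 2) (!e) (.var (1 : Fin 2))
    (.snoc (.snoc .nil
      (.var (0 : Fin 2)) false (.cont (starC (.vars 2))))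
      (.var (0 : Fin 2)) true (.cont (genC (Ψ := .vars 2) a (.var (1 : Fin 2)))))
    (t.sub (Subst.wk (.vars 1)))

/-- The face `ℓ = e` of `appendFill e a t`. -/
def append (e : Bool) (a : X) (t : Tm (CellName X) (.vars 1)) : Tm (CellName X) (.vars 1) :=
  (appendFill e a t).sub (Subst.inst (Ψ := .vars 1) (.const e))

/-- The path over `(i)` that encodes a word: the empty word gives `⋆`; a final letter `a` appends
with `e = 1`, and a final letter `a⁻¹` appends with `e = 0`. -/
def wordPath (w : Word X) : Tm (CellName X) (.vars 1) :=
  w.foldl (fun t x => append x.2 x.1 t) (.cont (starC (.vars 1)))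

/-- The boundary `[i = 0 ↪ ⋆, i = 1 ↪ ⋆, k = 0 ↪ v(i), k = 1 ↪ w(i)]` over `(i, k)`. -/
def wordBdy (v w : Word X) : KBdy (CellName X) 0 (.vars 2) :=
  .snoc (.snoc (.snoc (.snoc .nil
    (.var (0 : Fin 2)) false (.cont (starC (.vars 1))))
    (.var (0 : Fin 2)) true (.cont (starC (.vars 1))))
    (.var (1 : Fin 2)) false (wordPath v))
    (.var (1 : Fin 2)) true (wordPath w)

end Encoding

end CubicalKan

/-!
The statement relates squares between encoded words to equality in the presented group, and the two
directions rest on two observations.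

A square forces equality, because the group `G` supports a model of the calculus. A dimension
context is interpreted by its set of Boolean points (`Pt`; the inconsistent context has none), a
contortion by the map of points that evaluates its terms, and a cell by a `G`-valued cocycle, that
is, by a functor from the codiscrete groupoid on the points to `G`. Boolean evaluation satisfies the
De Morgan laws, so one model serves all four contortion theories. The cell variables are interpreted
by coboundaries of explicit potentials, which exist on the squares exactly because `a b c⁻¹ = 1`
holds in `G` (`GroupPresentation.models_ctx`). A filler is interpreted by its base, conjugated by
the transport along those faces of the open box that pass through the given point; this choice is
pointwise, hence stable under substitution. `KanEq.sem_eq` shows that equal Kan cells have equal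
interpretations, by a simultaneous induction in which well-formed boundaries are shown to be
coherent, i.e. the transport does not depend on the face used to compute it. The path of a word is
interpreted by the group element it represents (`sem_wordPath`), and the cocycle condition on a
square with constant vertical sides identifies the two elements (`eval_eq_of_hasKanBdy`).

Conversely, squares are built from fillers of three-dimensional open boxes, of a single shape
(`IsSquare.comp`) that involves only atomic terms and is therefore available in every contortion
theory. With the relation `Slides r p q` (a square from `p` to `q` whose right side is the loop `r`)
such boxes show that homotopy of loops is an equivalence relation, that appending a letter respects
it, that appending a letter and then its inverse changes nothing, and, filling against the square
`s_{a,b,c}`, that appending `a` and `b` amounts to appending `c`. Thus appending letters defines a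
right action of the presented group on homotopy classes of words. Two words that represent the same
group element act in the same way on the class of the empty word, so they are homotopic
(`GroupPresentation.slides_wordPath`).
-/

namespace CubicalKan

/-! ### Boolean points of dimension contexts -/

/-- The Boolean points of a dimension context; the inconsistent context has none. -/
@[ext] structure Pt (Ψ : DimCtx) : Type where
  val : Ψ.Var → Bool
  ne_bot : Ψ ≠ .bot

/-- The value of a dimension term at a Boolean point. -/
def DimTerm.eval {Ψ : DimCtx} (x : Pt Ψ) : DimTerm Ψ → Bool
  | .var i => x.val i
  | .const b => b
  | .neg r => !(r.eval x)
  | .sup r s => r.eval x || s.eval x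
  | .inf r s => r.eval x && s.eval x

/-- The value of an atomic term at a Boolean point. -/
def Atom.eval {Ψ : DimCtx} (x : Pt Ψ) : Atom Ψ → Bool
  | .var i => x.val i
  | .const b => b

theorem DimEq.eval_eq {Ψ : DimCtx} {r s : DimTerm Ψ} (h : DimEq r s) (x : Pt Ψ) :
    r.eval x = s.eval x := by
  induction h with
  | refl => rfl
  | symm _ ih => exact ih.symm
  | trans _ _ ih ih' => exact ih.trans ih'
  | neg_congr _ ih => simp [DimTerm.eval, ih]
  | sup_congr _ _ ih ih' => simp [DimTerm.eval, ih, ih']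
  | inf_congr _ _ ih ih' => simp [DimTerm.eval, ih, ih']
  | sup_comm => simp [DimTerm.eval, Bool.or_comm]
  | sup_assoc => simp [DimTerm.eval, Bool.or_assoc]
  | distrib => simp [DimTerm.eval, Bool.and_or_distrib_left]
  | bot h => exact absurd h x.ne_bot
  | _ => simp [DimTerm.eval]

/-- A contortion acts on Boolean points by evaluating its terms. -/
def Contortion.map {Ψ' Ψ : DimCtx} (ψ : Contortion Ψ' Ψ) (x : Pt Ψ') : Pt Ψ :=
  ⟨fun i => (ψ.toFun i).eval x, fun h => x.ne_bot (ψ.bot_of_bot h)⟩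

/-- A substitution acts on Boolean points by evaluating its terms. -/
def Subst.map {Ψ' Ψ : DimCtx} (σ : Subst Ψ' Ψ) (x : Pt Ψ') : Pt Ψ :=
  ⟨fun i => (σ.toFun i).eval x, fun h => x.ne_bot (σ.bot_of_bot h)⟩

theorem DimTerm.eval_act {Ψ' Ψ : DimCtx} (ψ : Contortion Ψ' Ψ) (x : Pt Ψ') (r : DimTerm Ψ) :
    (r.act ψ).eval x = r.eval (ψ.map x) := by
  induction r <;> simp_all [DimTerm.act, DimTerm.eval, Contortion.map]

@[simp] theorem Atom.eval_toTerm {Ψ : DimCtx} (x : Pt Ψ) (r : Atom Ψ) :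
    r.toTerm.eval x = r.eval x := by
  cases r <;> rfl

@[simp] theorem Atom.eval_sub {Ψ' Ψ : DimCtx} (σ : Subst Ψ' Ψ) (x : Pt Ψ') (r : Atom Ψ) :
    (r.sub σ).eval x = r.eval (σ.map x) := by
  cases r <;> rfl

@[simp] theorem Contortion.map_comp {Ψ'' Ψ' Ψ : DimCtx} (ψ : Contortion Ψ' Ψ)
    (ψ' : Contortion Ψ'' Ψ') (x : Pt Ψ'') : (ψ.comp ψ').map x = ψ.map (ψ'.map x) :=
  Pt.ext (funext fun _ => DimTerm.eval_act ψ' x _)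

@[simp] theorem Subst.map_toContortion {Ψ' Ψ : DimCtx} (σ : Subst Ψ' Ψ) (x : Pt Ψ') :
    σ.toContortion.map x = σ.map x :=
  Pt.ext (funext fun _ => Atom.eval_toTerm x _)

@[simp] theorem Subst.map_comp {Ψ'' Ψ' Ψ : DimCtx} (σ : Subst Ψ' Ψ) (τ : Subst Ψ'' Ψ')
    (x : Pt Ψ'') : (σ.comp τ).map x = σ.map (τ.map x) :=
  Pt.ext (funext fun _ => Atom.eval_sub τ x _)

@[simp] theorem Subst.map_id {Ψ : DimCtx} (x : Pt Ψ) : (Subst.id Ψ).map x = x := rfl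

/-- The extension of a Boolean point by one new coordinate. -/
def Pt.snoc : {Ψ : DimCtx} → Pt Ψ → Bool → Pt Ψ.ext
  | .vars n, x, b => ⟨fun i : Fin (n + 1) => Fin.lastCases (motive := fun _ => Bool) b x.val i,
      fun h => DimCtx.noConfusion h⟩
  | .bot, x, _ => x

/-- The extension of a Boolean point by `m` new coordinates, all equal to `b`. -/
def Pt.snocBy {Ψ : DimCtx} (x : Pt Ψ) (b : Bool) : (m : ℕ) → Pt (Ψ.extBy m)
  | 0 => x
  | m + 1 => (x.snocBy b m).snoc b

@[simp] theorem Subst.map_snoc {Ψ' Ψ : DimCtx} (σ : Subst Ψ' Ψ) (r : Atom Ψ') (x : Pt Ψ') :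
    (σ.snoc r).map x = (σ.map x).snoc (r.eval x) := by
  cases Ψ with
  | bot => rfl
  | vars n =>
    refine Pt.ext (funext fun i : Fin (n + 1) => ?_)
    refine Fin.lastCases ?_ (fun j => ?_) i <;> simp [Subst.map, Subst.snoc, Pt.snoc]

@[simp] theorem Subst.map_instBy {Ψ : DimCtx} (r : Atom Ψ) (m : ℕ) (x : Pt Ψ) :
    (Subst.instBy r m).map x = x.snocBy (r.eval x) m := by
  induction m with
  | zero => rfl
  | succ m ih => simp [Subst.instBy, Pt.snocBy, ih]

@[simp] theorem Subst.map_wk_snoc {Ψ : DimCtx} (x : Pt Ψ) (b : Bool) :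
    (Subst.wk Ψ).map (x.snoc b) = x := by
  cases Ψ with
  | bot => rfl
  | vars n =>
    refine Pt.ext (funext fun i : Fin n => ?_)
    simp [Subst.map, Subst.wk, Pt.snoc, Atom.eval]

@[simp] theorem eval_newVar_snoc {Ψ : DimCtx} (x : Pt Ψ) (b : Bool) :
    (newVar Ψ).eval (x.snoc b) = b := by
  cases Ψ with
  | bot => exact absurd rfl x.ne_bot
  | vars n => simp [newVar, Pt.snoc, Atom.eval]

@[simp] theorem Subst.map_extBy {Ψ' Ψ : DimCtx} (σ : Subst Ψ' Ψ) (m : ℕ) (x : Pt Ψ') (b : Bool) :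
    (σ.extBy m).map (x.snocBy b m) = (σ.map x).snocBy b m := by
  induction m with
  | zero => rfl
  | succ m ih => simp [Subst.extBy, Subst.ext1, Pt.snocBy, ih]

theorem Pt.con_ne_bot {Ψ : DimCtx} (x : Pt Ψ) {r : Atom Ψ} {e : Bool} (h : r.eval x = e) :
    Ψ.con r e ≠ .bot := by
  obtain ⟨x, hx⟩ := x
  cases Ψ with
  | bot => exact absurd rfl hx
  | vars n =>
    cases r with
    | var i =>
      cases n with
      | zero => exact Fin.elim0 i
      | succ n => exact fun h => DimCtx.noConfusion h
    | const b =>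
      obtain rfl : b = e := h
      cases b <;> exact fun h => DimCtx.noConfusion h

/-- A Boolean point that satisfies a constraint is a point of the constrained context. -/
def Pt.lift {Ψ : DimCtx} (x : Pt Ψ) {r : Atom Ψ} {e : Bool} (h : r.eval x = e) :
    Pt (Ψ.con r e) :=
  ⟨fun j => x.val (conVar r e j), x.con_ne_bot h⟩

@[simp] theorem eval_map_inclcon {Ψ : DimCtx} (r : Atom Ψ) (e : Bool) (x : Pt (Ψ.con r e)) :
    r.eval ((inclcon r e).map x) = e := by
  cases Ψ with
  | bot => exact absurd (con_bot r e) x.ne_bot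
  | vars n =>
    cases r with
    | var i =>
      cases n with
      | zero => exact Fin.elim0 i
      | succ n => simp [Atom.eval, Subst.map, inclcon, dropSub]
    | const b => cases b <;> cases e <;> first | rfl | exact absurd rfl x.ne_bot

@[simp] theorem Pt.map_inclcon_lift {Ψ : DimCtx} (x : Pt Ψ) {r : Atom Ψ} {e : Bool}
    (h : r.eval x = e) : (inclcon r e).map (x.lift h) = x := by
  refine Pt.ext (funext fun k => ?_)
  cases Ψ with
  | bot => exact Empty.elim k
  | vars n =>
    cases r with
    | var i =>
      cases n with
      | zero => exact Fin.elim0 i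
      | succ n =>
        change Fin (n + 1) at i k
        subst h
        refine Fin.succAboveCases (α := fun k => ((inclcon _ _).map (x.lift rfl)).val k = x.val k)
          i ?_ (fun j => ?_) k <;>
          simp [Atom.eval, Subst.map, inclcon, dropSub, Pt.lift, conVar, dropVar]
    | const b =>
      obtain rfl : b = e := h
      cases b <;> rfl

theorem inclcon_map_injective {Ψ : DimCtx} (r : Atom Ψ) (e : Bool) :
    Function.Injective (inclcon r e).map := by
  intro x y h
  cases Ψ with
  | bot => exact absurd (con_bot r e) x.ne_bot
  | vars n =>
    cases r with
    | var i =>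
      cases n with
      | zero => exact Fin.elim0 i
      | succ n =>
        refine Pt.ext (funext fun j : Fin n => ?_)
        simpa [Subst.map, inclcon, dropSub, Atom.eval] using
          congrFun (congrArg Pt.val h) (Fin.succAbove (n := n) i j)
    | const b => cases b <;> cases e <;> first | exact h | exact absurd rfl x.ne_bot

@[simp] theorem Pt.lift_map_inclcon {Ψ : DimCtx} {r : Atom Ψ} {e : Bool} (x : Pt (Ψ.con r e))
    (h : r.eval ((inclcon r e).map x) = e) : ((inclcon r e).map x).lift h = x :=
  inclcon_map_injective r e (Pt.map_inclcon_lift _ h)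

@[simp] theorem map_inclcon_con {Ψ' Ψ : DimCtx} (σ : Subst Ψ' Ψ) (r : Atom Ψ) (e : Bool)
    (x : Pt (Ψ'.con (r.sub σ) e)) :
    (inclcon r e).map ((σ.con r e).map x) = σ.map ((inclcon (r.sub σ) e).map x) := by
  have h : r.eval (σ.map ((inclcon (r.sub σ) e).map x)) = e := by
    rw [← Atom.eval_sub, eval_map_inclcon]
  rw [← Pt.map_inclcon_lift _ h]
  congr 1
  exact Pt.ext (funext fun j => Atom.eval_sub _ _ _)

/-! ### Interpretation of cells by cocycles -/

section Semantics

variable {V : Type u} {G : Type*} [Group G] (h : V → (Ψ : DimCtx) → Pt Ψ → G)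

/-- The interpretation of a contorted cell: `h` gives a potential for each cell variable, and the
cell is the coboundary of the potential pulled back along the contortion. -/
def CCell.sem {Ψ : DimCtx} (c : CCell V Ψ) (x y : Pt Ψ) : G :=
  (h c.name c.dim (c.arg.map x))⁻¹ * h c.name c.dim (c.arg.map y)

mutual

/-- The interpretation of a raw Kan cell as a `G`-valued cocycle on Boolean points. A filler is its
base, conjugated by the transport from `e` to `r` along the given faces. -/
def Tm.sem : {Ψ : DimCtx} → Tm V Ψ → Pt Ψ → Pt Ψ → G
  | _, .cont c, x, y => c.sem h x y
  | _, .sub t σ, x, y => t.sem (σ.map x) (σ.map y)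
  | _, .fill e r φ u, x, y =>
      (φ.transp x e (r.eval x))⁻¹ * u.sem x y * φ.transp y e (r.eval y)

/-- The transport at the point `x` from `b` to `b'` (in all bound variables) along the last entry
of the boundary whose constraint holds at `x`; it is trivial if there is none. -/
def KBdy.transp : {m : ℕ} → {Ψ : DimCtx} → KBdy V m Ψ → Pt Ψ → Bool → Bool → G
  | _, _, .nil, _, _, _ => 1
  | m, _, .snoc φ r e t, x, b, b' =>
      if hx : r.eval x = e then t.sem ((x.lift hx).snocBy b m) ((x.lift hx).snocBy b' m)
      else φ.transp x b b'

end

theorem CCell.sem_mul {Ψ : DimCtx} (c : CCell V Ψ) (x y z : Pt Ψ) :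
    c.sem h x y * c.sem h y z = c.sem h x z := by
  simp [CCell.sem, mul_assoc]

/-- The cocycle condition; it holds for all raw cells, well-formed or not. -/
theorem Tm.sem_mul : {Ψ : DimCtx} → (t : Tm V Ψ) → (x y z : Pt Ψ) →
    t.sem h x y * t.sem h y z = t.sem h x z
  | _, .cont c, x, y, z => by simp only [Tm.sem, CCell.sem_mul]
  | _, .sub t σ, x, y, z => by simp only [Tm.sem, Tm.sem_mul t]
  | _, .fill e r φ u, x, y, z => by
      simp only [Tm.sem, ← Tm.sem_mul u x y z]
      group

theorem Tm.sem_self {Ψ : DimCtx} (t : Tm V Ψ) (x : Pt Ψ) : t.sem h x x = 1 := by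
  simpa using t.sem_mul h x x x

/-- The transport along a constant path is trivial, so a filler restricts to its base. -/
theorem KBdy.transp_self : {m : ℕ} → {Ψ : DimCtx} → (φ : KBdy V m Ψ) → (x : Pt Ψ) →
    (b : Bool) → φ.transp h x b b = 1
  | _, _, .nil, _, _ => by simp only [KBdy.transp]
  | _, _, .snoc φ r e t, x, b => by
      simp only [KBdy.transp, Tm.sem_self, KBdy.transp_self φ, dite_eq_ite, ite_self]

theorem KBdy.transp_sub : {m : ℕ} → {Ψ : DimCtx} → (φ : KBdy V m Ψ) → {Ψ' : DimCtx} →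
    (σ : Subst Ψ' Ψ) → (x : Pt Ψ') → (b b' : Bool) →
    (φ.sub σ).transp h x b b' = φ.transp h (σ.map x) b b'
  | _, _, .nil, _, _, _, _, _ => by simp only [KBdy.sub, KBdy.transp]
  | _, _, .snoc φ r e t, _, σ, x, b, b' => by
      simp only [KBdy.sub, KBdy.transp, KBdy.transp_sub φ, Tm.sem, Subst.map_extBy, Atom.eval_sub]
      split_ifs with hx
      · have : (σ.con r e).map (x.lift ((Atom.eval_sub σ x r).trans hx)) = (σ.map x).lift hx :=
          inclcon_map_injective r e (by simp)
        rw [this]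
      · rfl

theorem KBdy.Mem.sub {m : ℕ} {Ψ Ψ' : DimCtx} {φ : KBdy V m Ψ} {r : Atom Ψ} {e : Bool}
    {t : Tm V ((Ψ.con r e).extBy m)} (ht : φ.Mem r e t) (σ : Subst Ψ' Ψ) :
    (φ.sub σ).Mem (r.sub σ) e (t.sub ((σ.con r e).extBy m)) := by
  induction ht with
  | here => exact .here
  | there _ ih => exact .there ih

theorem KBdy.Mem.inst {m : ℕ} {Ψ : DimCtx} {φ : KBdy V m Ψ} {s : Atom Ψ} {e : Bool}
    {t : Tm V ((Ψ.con s e).extBy m)} (ht : φ.Mem s e t) (r : Atom Ψ) :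
    (φ.inst r).Mem s e (t.sub (Subst.instBy (r.sub (inclcon s e)) m)) := by
  induction ht with
  | here => exact .here
  | there _ ih => exact .there ih

theorem KBdy.Mem.of_inst {m : ℕ} {Ψ : DimCtx} : {φ : KBdy V m Ψ} → {r s : Atom Ψ} → {e : Bool} →
    {t : Tm V (Ψ.con s e)} → (φ.inst r).Mem s e t →
    ∃ t₀, φ.Mem s e t₀ ∧ t = t₀.sub (Subst.instBy (r.sub (inclcon s e)) m)
  | .nil, _, _, _, _, ht => by cases ht
  | .snoc φ _ _ _, _, _, _, _, ht => by
    cases ht with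
    | here => exact ⟨_, .here, rfl⟩
    | there ht =>
      obtain ⟨t₀, h₀, h₁⟩ := KBdy.Mem.of_inst ht
      exact ⟨t₀, .there h₀, h₁⟩

/-- The transport along a boundary may be computed with any applicable entry. -/
def KBdy.Coherent {m : ℕ} {Ψ : DimCtx} (φ : KBdy V m Ψ) : Prop :=
  ∀ r e t, φ.Mem r e t → ∀ (x : Pt (Ψ.con r e)) (b b' : Bool),
    φ.transp h ((inclcon r e).map x) b b' = t.sem h (x.snocBy b m) (x.snocBy b' m)

/-- If the raw cell is a filler, it fills an open box in the model: its boundary is coherent and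
agrees with its base. Other raw cells satisfy no condition. -/
def Tm.IsBox : {Ψ : DimCtx} → Tm V Ψ → Prop
  | _, .cont _ => True
  | _, .sub _ _ => True
  | Ψ, .fill e _ φ u => φ.Coherent h ∧
      ∀ s e' t, φ.Mem s e' t → ∀ x y : Pt (Ψ.con s e'),
        u.sem h ((inclcon s e').map x) ((inclcon s e').map y) = t.sem h (x.snoc e) (y.snoc e)

/-- Each declared cell has, in the model, the boundary with which it is declared. -/
def Models (Γ : Ctx V) : Prop :=
  ∀ d ∈ Γ, ∀ r e t, d.bdy.Mem r e t → ∀ x y : Pt (d.dim.con r e),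
    t.sem h x y = (h d.name d.dim ((inclcon r e).map x))⁻¹ * h d.name d.dim ((inclcon r e).map y)

variable {h}

/-- Where the constraint of the new entry and that of an old one both hold, the two entries agree,
so it does not matter which of them is used to compute the transport. -/
theorem KBdy.Coherent.snoc {m : ℕ} {Ψ : DimCtx} {φ : KBdy V m Ψ} {r : Atom Ψ} {e : Bool}
    {t : Tm V ((Ψ.con r e).extBy m)} (hφ : φ.Coherent h)
    (ht : ∀ s e' t', (φ.sub (inclcon r e)).Mem s e' t' →
      (t.sub ((inclcon s e').extBy m)).sem h = t'.sem h) :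
    (KBdy.snoc φ r e t).Coherent h := by
  intro s e' t' hm x b b'
  cases hm with
  | here => simp [KBdy.transp]
  | there hm =>
    rw [KBdy.transp]
    split_ifs with hx
    -- `y.lift hz` is the given point, as a point of the overlap of the two constraints.
    · set y := ((inclcon s e').map x).lift hx with hy
      have hz : (s.sub (inclcon r e)).eval y = e' := by simp [hy]
      have key := congrFun (congrFun (ht _ _ _ (hm.sub (inclcon r e)))
        ((y.lift hz).snocBy b m)) ((y.lift hz).snocBy b' m)
      have hxz : ((inclcon r e).con s e').map (y.lift hz) = x :=
        inclcon_map_injective s e' (by simp [hy])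
      simpa [Tm.sem, hxz] using key
    · exact hφ _ _ _ hm x b b'

variable {T : ContortionTheory} {Γ : Ctx V}

theorem CEq.sem_eq (hΓ : Models h Γ) {Ψ : DimCtx} {c c' : CCell V Ψ} (hc : CEq T Γ c c') :
    c.sem h = c'.sem h := by
  induction hc with
  | refl => rfl
  | symm _ ih => exact ih.symm
  | trans _ _ ih ih' => exact ih.trans ih'
  | @dim Ψ Ψ₀ a ψ ψ' _ _ he =>
    have : ψ.map = ψ'.map := funext fun x => Pt.ext (funext fun i => (he i).eval_eq x)
    simp only [CCell.sem, this, funext_iff, implies_true]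
  | bot => exact funext fun x => absurd rfl x.ne_bot
  | @bdy Ψ d r e t ψ ψ₀ hd hm _ hr hψ =>
    have hx : ∀ x, (inclcon r e).map (ψ₀.map x) = ψ.map x := by
      intro x
      have hre : r.eval (ψ.map x) = e := by
        have := hr.eval_eq x
        rwa [DimTerm.eval_act, Atom.eval_toTerm] at this
      rw [← Pt.map_inclcon_lift _ hre]
      congr 1
      exact Pt.ext (funext fun j => by simp [Contortion.map, Pt.lift, hψ])
    funext x y
    have := hΓ d hd r e t hm (ψ₀.map x) (ψ₀.map y)
    rw [hx, hx] at this
    rw [CCell.sem, ← this]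
    simp [CCell.sem, CCell.act]

/-- Equality of Kan cells is sound for the interpretation by cocycles. -/
theorem KanEq.sem_eq (hΓ : Models h Γ) {Ψ : DimCtx} {t t' : Tm V Ψ} (ht : KanEq T Γ t t') :
    t.sem h = t'.sem h := by
  -- The induction runs over all four judgments at once: well-formed fillers are open boxes in the
  -- model and well-formed boundaries are coherent, which is what the rule for sides needs.
  refine KanEq.rec (motive_1 := fun {_} t _ => t.IsBox h)
    (motive_2 := fun {_ _} φ _ => φ.Coherent h)
    (motive_3 := fun {_} t t' _ => t.sem h = t'.sem h)
    (motive_4 := fun {_ _} φ φ' _ => φ.transp h = φ'.transp h)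
    ?isKan_cont ?isKan_sub ?isKan_fill ?isKanBdy_nil ?isKanBdy_snoc ?refl ?symm ?trans ?bot ?cont
    ?sub_congr ?fill_congr ?sub_id ?sub_comp ?sub_cont ?sub_fill ?fill_side ?fill_base ?nil ?snoc ht
  case isKan_cont => intros; trivial
  case isKan_sub => intros; trivial
  case isKan_fill =>
    intro Ψ e r φ u _ _ _ hφ _ hu
    refine ⟨hφ, fun s e' t hm x y => ?_⟩
    have := congrFun (congrFun (hu _ _ _ (hm.inst (.const e))) x) y
    simpa [Tm.sem, Atom.sub, Atom.eval, Pt.snocBy] using this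
  case isKanBdy_nil => intro m Ψ r e t hm; cases hm
  case isKanBdy_snoc =>
    intro m Ψ φ r e t _ _ _ hφ _ ht
    exact hφ.snoc ht
  case refl => intros; rfl
  case symm => intro _ _ _ _ ih; exact ih.symm
  case trans => intro _ _ _ _ _ _ ih ih'; exact ih.trans ih'
  case bot => intros; exact funext fun x => absurd rfl x.ne_bot
  case cont =>
    intro Ψ c c' hc
    funext x y
    simp only [Tm.sem, hc.sem_eq hΓ]
  case sub_congr =>
    intro _ _ _ _ _ _ ih
    funext x y
    simp only [Tm.sem, ih]
  case fill_congr =>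
    intro _ _ _ _ _ _ _ _ _ _ _ _ _ hφ hu
    funext x y
    simp only [Tm.sem, hφ, hu]
  case sub_id => intros; funext x y; simp only [Tm.sem, Subst.map_id]
  case sub_comp => intros; funext x y; simp only [Tm.sem, Subst.map_comp]
  case sub_cont =>
    intros; funext x y
    simp [Tm.sem, CCell.sem, CCell.sub, CCell.act]
  case sub_fill =>
    intros; funext x y
    simp only [Tm.sem, KBdy.transp_sub, Atom.eval_sub]
  case fill_side =>
    intro Ψ e r φ u s e' t _ hm hb
    obtain ⟨t₀, h₀, rfl⟩ := hm.of_inst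
    funext x y
    -- Transport along the entry `t₀` carries the edge of `t₀` at `e` to its edge at `r`.
    have hφ := hb.1 _ _ _ h₀
    have hu := hb.2 _ _ _ h₀ x y
    simp only [Tm.sem, hφ, hu, Subst.map_instBy, Atom.eval_sub, Pt.snocBy]
    rw [mul_assoc, inv_mul_eq_iff_eq_mul, t₀.sem_mul, t₀.sem_mul]
  case fill_base =>
    intro Ψ e r φ u _ _
    funext x y
    simp [Tm.sem, KBdy.transp_self]
  case nil => intros; rfl
  case snoc =>
    intro _ _ _ _ _ _ _ _ _ _ hφ ht
    funext x b b'
    simp only [KBdy.transp, hφ, ht]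

end Semantics

/-! ### The model of a presentation -/

namespace GroupPresentation

variable {X : Type u} (P : GroupPresentation X)

@[simp] theorem eval_nil : P.eval [] = 1 := rfl

theorem eval_append (v w : Word X) : P.eval (v ++ w) = P.eval v * P.eval w := rfl

theorem eval_inv (a : X) : P.eval [(a, false)] = (P.eval [(a, true)])⁻¹ := rfl

theorem eval_eq_one {w : Word X} (hw : w ∈ P.rels) : P.eval w = 1 :=
  PresentedGroup.one_of_mem ⟨w, hw, rfl⟩

theorem eval_triangle {a b c : X} (h : triangle a b c ∈ P.rels) :
    P.eval [(a, true)] * P.eval [(b, true)] = P.eval [(c, true)] := by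
  rw [← mul_inv_eq_one, ← eval_inv, ← eval_append, ← eval_append]
  exact P.eval_eq_one h

/-- The potentials of the declared cells: the vertices of a loop or square are labelled by the
group elements that the paths from the initial vertex represent. -/
def potential : CellName X → (Ψ : DimCtx) → Pt Ψ → P.G
  | .gen a, .vars 1, x => if x.val (0 : Fin 1) then P.eval [(a, true)] else 1
  | .sq a _ c, .vars 2, x =>
      if x.val (0 : Fin 2) then
        if x.val (1 : Fin 2) then P.eval [(c, true)] else P.eval [(a, true)]
      else 1
  | _, _, _ => 1

variable [Fintype X]

theorem mem_ctx {d : Decl (CellName X)} : d ∈ P.ctx ↔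
    (∃ a b c, triangle a b c ∈ P.rels ∧ sqDecl a b c = d) ∨ (∃ a, genDecl a = d) ∨
      d = starDecl := by
  simp [ctx, triples]

theorem models_ctx : Models P.potential P.ctx := by
  intro d hd r e t hm x y
  rcases P.mem_ctx.1 hd with ⟨a, b, c, hR, rfl⟩ | ⟨a, rfl⟩ | rfl
  · have hc := P.eval_triangle hR
    -- The face `k = b` keeps the variable `j`.
    have h₀ : ∀ b, (Fin.insertNth (n := 1) (α := fun _ => Atom (.vars 1)) 1 (.const b)
        (fun j => .var j) 0) = .var (0 : Fin 1) := fun _ => rfl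
    rcases hm with _ | ⟨_ | ⟨_ | ⟨_ | ⟨⟨⟩⟩⟩⟩⟩ <;>
      simp only [CCell.sem, genC, starC, sqDecl, potential, Contortion.map, Subst.map, inclcon,
        dropSub, DimTerm.eval, Atom.eval, Fin.insertNth_apply_same, h₀] <;>
      simp
    cases hx : x.val (0 : Fin 1) <;> cases hy : y.val (0 : Fin 1) <;> simp [← hc]
  · rcases hm with _ | ⟨_ | ⟨⟨⟩⟩⟩ <;>
      simp [CCell.sem, starC, genDecl, potential, Contortion.map, Subst.map, inclcon, dropSub,
        Atom.eval]
  · cases hm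

end GroupPresentation

section

variable {X : Type u} (P : GroupPresentation X)

/-- The transport along the faces of `appendFill`: trivial at the initial point of a path, and
given by the generator at its terminal point. -/
theorem transp_appendFill (a : X) (x : Pt (.vars 2)) (b b' : Bool) :
    (KBdy.snoc (m := 1) (Ψ := .vars 2) (.snoc .nil
      (.var (0 : Fin 2)) false (.cont (starC (.vars 2))))
      (.var (0 : Fin 2)) true (.cont (genC (Ψ := .vars 2) a (.var (1 : Fin 2))))).transp
        P.potential x b b' =
      if x.val (0 : Fin 2) then
        (if b then P.eval [(a, true)] else 1)⁻¹ * (if b' then P.eval [(a, true)] else 1)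
      else 1 := by
  cases hx : Atom.eval (Ψ := .vars 2) x (.var (0 : Fin 2))
  · rw [KBdy.transp, dif_neg (by simp [hx]), KBdy.transp, dif_pos hx]
    rw [Atom.eval] at hx
    simp [Tm.sem, CCell.sem, starC, GroupPresentation.potential, hx]
  · rw [KBdy.transp, dif_pos hx]
    rw [Atom.eval] at hx
    rw [hx]
    rfl

theorem sem_append (e : Bool) (a : X) (t : Tm (CellName X) (.vars 1)) (x y : Pt (.vars 1))
    (hx : x.val (0 : Fin 1) = false) (hy : y.val (0 : Fin 1) = true) :
    (append e a t).sem P.potential x y = t.sem P.potential x y * P.eval [(a, e)] := by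
  have h₀ : ∀ z : Pt (.vars 1), (z.snoc e).val (0 : Fin 2) = z.val (0 : Fin 1) := fun _ => rfl
  have h₁ : ∀ z : Pt (.vars 1), (z.snoc e).val (1 : Fin 2) = e := fun _ => rfl
  have hs : ∀ z : Pt (.vars 1), (Subst.inst (Ψ := .vars 1) (.const e)).map z = z.snoc e :=
    fun z => Subst.map_snoc _ _ z
  simp only [append, appendFill, Tm.sem, hs, transp_appendFill, Atom.eval, h₀, h₁, hx, hy,
    Subst.map_wk_snoc]
  cases e <;> simp [GroupPresentation.eval_inv]

/-- The path of a word is interpreted, on the edge from `0` to `1`, by the element that the word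
represents. -/
theorem sem_wordPath (w : Word X) (x y : Pt (.vars 1))
    (hx : x.val (0 : Fin 1) = false) (hy : y.val (0 : Fin 1) = true) :
    (wordPath w).sem P.potential x y = P.eval w := by
  induction w using List.reverseRecOn with
  | nil => simp [wordPath, Tm.sem, CCell.sem, starC, GroupPresentation.potential]
  | append_singleton w a ih =>
    rw [P.eval_append, ← ih, ← sem_append P _ _ _ x y hx hy]
    simp [wordPath]

/-- In the model, the value of a horizontal side of a square with constant vertical sides is that of
the opposite side. -/
theorem eval_eq_of_hasKanBdy [Fintype X] {T : ContortionTheory} {v w : Word X}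
    {t : Tm (CellName X) (.vars 2)} (ht : HasKanBdy T P.ctx t (wordBdy v w)) :
    P.eval v = P.eval w := by
  -- `p b` is the point `i = b` of the interval, `q b b'` the vertex `i = b, k = b'` of the square.
  let p : Bool → Pt (.vars 1) := fun b => ⟨fun _ => b, fun h => DimCtx.noConfusion h⟩
  let q : Bool → Bool → Pt (.vars 2) := fun b b' => (p b).snoc b'
  have key := fun r e t' hm => (ht.agrees r e t' hm).sem_eq P.models_ctx
  have hq₀ : ∀ b b', (inclcon (Ψ := .vars 2) (.var (0 : Fin 2)) b).map (p b') = q b b' :=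
    fun b b' => Pt.ext (funext fun i : Fin 2 => by fin_cases i <;> rfl)
  have hq₁ : ∀ b b', (inclcon (Ψ := .vars 2) (.var (1 : Fin 2)) b').map (p b) = q b b' :=
    fun b b' => Pt.ext (funext fun i : Fin 2 => by fin_cases i <;> rfl)
  have hstar : ∀ x y, (starC (.vars 1)).sem P.potential x y = 1 := fun x y => by
    simp [CCell.sem, starC, GroupPresentation.potential]
  -- The four faces, evaluated on the edge from `0` to `1`.
  have h₀ := congrFun (congrFun (key _ _ _ (.there (.there (.there .here)))) (p false)) (p true)
  have h₁ := congrFun (congrFun (key _ _ _ (.there (.there .here))) (p false)) (p true)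
  have hv := congrFun (congrFun (key _ _ _ (.there .here)) (p false)) (p true)
  have hw := congrFun (congrFun (key _ _ _ .here) (p false)) (p true)
  rw [sem_wordPath P _ _ _ rfl rfl, Tm.sem, hq₁, hq₁] at hv hw
  rw [Tm.sem, Tm.sem, hstar, hq₀, hq₀] at h₀ h₁
  rw [← hv, ← hw, ← mul_one (t.sem _ _ _), ← h₁, t.sem_mul, ← t.sem_mul _ _ (q false true), h₀,
    one_mul]

end

/-! ### Faces and agreement -/

theorem CBdy.forall_mem_snoc {V : Type u} {Ψ : DimCtx} {φ : CBdy V Ψ} {r : Atom Ψ} {e : Bool}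
    {t : CCell V (Ψ.con r e)} {Q : (s : Atom Ψ) → (e : Bool) → CCell V (Ψ.con s e) → Prop}
    (h₀ : Q r e t) (h : ∀ s e' t', φ.Mem s e' t' → Q s e' t') :
    ∀ s e' t', (CBdy.snoc φ r e t).Mem s e' t' → Q s e' t' := by
  intro s e' t' hm
  cases hm with
  | here => exact h₀
  | there hm => exact h _ _ _ hm

theorem CBdy.forall_mem_nil {V : Type u} {Ψ : DimCtx}
    {Q : (s : Atom Ψ) → (e : Bool) → CCell V (Ψ.con s e) → Prop} :
    ∀ s e' t', (CBdy.nil : CBdy V Ψ).Mem s e' t' → Q s e' t' := by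
  intro s e' t' hm
  cases hm

theorem KBdy.forall_mem_snoc {V : Type u} {m : ℕ} {Ψ : DimCtx} {φ : KBdy V m Ψ} {r : Atom Ψ}
    {e : Bool} {t : Tm V ((Ψ.con r e).extBy m)}
    {Q : (s : Atom Ψ) → (e : Bool) → Tm V ((Ψ.con s e).extBy m) → Prop}
    (h₀ : Q r e t) (h : ∀ s e' t', φ.Mem s e' t' → Q s e' t') :
    ∀ s e' t', (KBdy.snoc φ r e t).Mem s e' t' → Q s e' t' := by
  intro s e' t' hm
  cases hm with
  | here => exact h₀
  | there hm => exact h _ _ _ hm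

theorem KBdy.forall_mem_nil {V : Type u} {m : ℕ} {Ψ : DimCtx}
    {Q : (s : Atom Ψ) → (e : Bool) → Tm V ((Ψ.con s e).extBy m) → Prop} :
    ∀ s e' t', (KBdy.nil : KBdy V m Ψ).Mem s e' t' → Q s e' t' := by
  intro s e' t' hm
  cases hm

section

variable {V : Type u} {T : ContortionTheory} {Γ : Ctx V}

theorem Atom.inLang_toTerm {Ψ : DimCtx} (r : Atom Ψ) : r.toTerm.InLang T := by
  cases r <;> trivial

theorem DimTerm.InLang.sub {Ψ' Ψ : DimCtx} {r : DimTerm Ψ} (h : r.InLang T) (σ : Subst Ψ' Ψ) :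
    (r.act σ.toContortion).InLang T := by
  induction r with
  | var i => exact Atom.inLang_toTerm _
  | const b => trivial
  | neg r ih => exact ⟨h.1, ih h.2⟩
  | sup r s ih ih' => exact ⟨h.1, ih h.2.1, ih' h.2.2⟩
  | inf r s ih ih' => exact ⟨h.1, ih h.2.1, ih' h.2.2⟩

theorem IsCCell.sub {Ψ' Ψ : DimCtx} {c : CCell V Ψ} (h : IsCCell T Γ c) (σ : Subst Ψ' Ψ) :
    IsCCell T Γ (c.sub σ) :=
  ⟨h.1, fun i => (h.2 i).sub σ⟩

theorem CEq.of_bot {Ψ : DimCtx} (hΨ : Ψ = .bot) {c c' : CCell V Ψ} (h : IsCCell T Γ c)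
    (h' : IsCCell T Γ c') : CEq T Γ c c' := by
  subst hΨ
  exact .bot h h'

theorem KanEq.of_bot {Ψ : DimCtx} (hΨ : Ψ = .bot) {t t' : Tm V Ψ} (h : IsKan T Γ t)
    (h' : IsKan T Γ t') : KanEq T Γ t t' := by
  subst hΨ
  exact .bot h h'

/-- The face `i = e` of a Kan cell over a nonempty list of variables. -/
abbrev Tm.face {n : ℕ} (t : Tm V (.vars (n + 1))) (i : Fin (n + 1)) (e : Bool) : Tm V (.vars n) :=
  t.sub (inclcon (Ψ := .vars (n + 1)) (.var i) e)

theorem KanEq.sub_sub {Ψ Ψ₁ Ψ₂ Ψ' : DimCtx} {t : Tm V Ψ} (ht : IsKan T Γ t) {σ : Subst Ψ₁ Ψ}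
    {τ : Subst Ψ' Ψ₁} {σ' : Subst Ψ₂ Ψ} {τ' : Subst Ψ' Ψ₂} (h : σ.comp τ = σ'.comp τ') :
    KanEq T Γ ((t.sub σ).sub τ) ((t.sub σ').sub τ') :=
  (KanEq.sub_comp ht).trans (h ▸ (KanEq.sub_comp ht).symm)

theorem KanEq.sub_sub_id {Ψ Ψ' : DimCtx} {t : Tm V Ψ} (ht : IsKan T Γ t) {σ : Subst Ψ' Ψ}
    {τ : Subst Ψ Ψ'} (h : σ.comp τ = Subst.id Ψ) : KanEq T Γ ((t.sub σ).sub τ) t :=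
  (KanEq.sub_comp ht).trans (h ▸ KanEq.sub_id ht)

theorem KanEq.of_sub_eq {Ψ Ψ' : DimCtx} {t : Tm V Ψ} (ht : IsKan T Γ t) {σ τ : Subst Ψ' Ψ}
    (h : σ = τ) : KanEq T Γ (t.sub σ) (t.sub τ) :=
  h ▸ .refl (.sub ht)

end

/-! ### Cells of the encoding -/

section

variable {X : Type u} {T : ContortionTheory} {Γ : Ctx (CellName X)}

/-- The contorted cell `s_{a,b,c}(r, s)`, with `r` for `j` and `s` for `k`. -/
def sqC {Ψ : DimCtx} (a b c : X) (r s : DimTerm Ψ) : CCell (CellName X) Ψ :=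
  ⟨.sq a b c, .vars 2, fun i : Fin 2 => Fin.cases r (fun _ => s) i, fun h => DimCtx.noConfusion h⟩

theorem starC_act {Ψ Ψ' : DimCtx} (ψ : Contortion Ψ' Ψ) :
    (starC Ψ : CCell (CellName X) Ψ).act ψ = starC Ψ' := by
  simp only [CCell.act, starC, CCell.mk.injEq, heq_eq_eq, true_and]
  exact Contortion.ext (funext fun i => Fin.elim0 i)

theorem starC_sub {Ψ Ψ' : DimCtx} (σ : Subst Ψ' Ψ) :
    (starC Ψ : CCell (CellName X) Ψ).sub σ = starC Ψ' :=
  starC_act _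

theorem sqC_act {Ψ Ψ' : DimCtx} (a b c : X) (r s : DimTerm Ψ) (ψ : Contortion Ψ' Ψ) :
    (sqC a b c r s).act ψ = sqC a b c (r.act ψ) (s.act ψ) := by
  simp only [CCell.act, sqC, CCell.mk.injEq, heq_eq_eq, true_and]
  refine Contortion.ext (funext fun i : Fin 2 => ?_)
  fin_cases i <;> rfl

theorem isCCell_starC (hs : starDecl ∈ Γ) (Ψ : DimCtx) : IsCCell T Γ (starC Ψ) :=
  ⟨⟨_, hs⟩, fun i => Fin.elim0 i⟩

theorem isCCell_genC {Ψ : DimCtx} {a : X} {r : DimTerm Ψ} (ha : genDecl a ∈ Γ) (hr : r.InLang T) :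
    IsCCell T Γ (genC a r) :=
  ⟨⟨_, ha⟩, fun _ => hr⟩

theorem isCCell_sqC {Ψ : DimCtx} {a b c : X} {r s : DimTerm Ψ} (h : sqDecl a b c ∈ Γ)
    (hr : r.InLang T) (hs : s.InLang T) : IsCCell T Γ (sqC a b c r s) :=
  ⟨⟨_, h⟩, fun i : Fin 2 => by fin_cases i <;> assumption⟩

/-- The endpoints of the loop `â` are `⋆`. -/
theorem CEq.genC_const {Ψ : DimCtx} {a : X} (ha : genDecl a ∈ Γ) (e : Bool) :
    CEq T Γ (genC a (.const e : DimTerm Ψ)) (starC Ψ) := by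
  rw [← starC_act (Ψ := .vars 0) ⟨fun i => Fin.elim0 i, fun h => DimCtx.noConfusion h⟩]
  refine CEq.bdy (d := genDecl a) (r := .var (0 : Fin 1)) (e := e) (t := starC (.vars 0)) ha ?_
    (fun _ => trivial) (.refl _) fun j => Fin.elim0 j
  cases e
  · exact .there .here
  · exact .here

/-- The square `s_{a,b,c}` with an endpoint substituted for its variable `i` is the corresponding
face. -/
theorem CEq.sqC_bdy {Ψ : DimCtx} {a b c : X} {r s : DimTerm Ψ} (h : sqDecl a b c ∈ Γ)
    (hr : r.InLang T) (hs : s.InLang T) {i : Fin 2} {e : Bool} {t : CCell (CellName X) (.vars 1)}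
    {t' : CCell (CellName X) Ψ} (ht : (sqDecl a b c).bdy.Mem (.var i) e t)
    (hi : (Fin.cases r (fun _ => s) i : DimTerm Ψ) = .const e)
    (ht' : t.act ⟨fun _ => Fin.cases r (fun _ => s) (i.succAbove (0 : Fin 1)),
      fun h => DimCtx.noConfusion h⟩ = t') :
    CEq T Γ (sqC a b c r s) t' := by
  subst ht'
  refine CEq.bdy (d := sqDecl a b c) (r := .var i) (e := e) h ht
    (fun i : Fin 2 => by fin_cases i <;> assumption) ?_ fun j : Fin 1 => ?_
  · exact hi ▸ .refl _
  · obtain rfl : j = 0 := Subsingleton.elim _ _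
    rfl

end

/-! ### The context of a presentation -/

section

variable {X : Type u} {T : ContortionTheory} {Γ : Ctx (CellName X)}

theorem CEq.starC_sub (hs : starDecl ∈ Γ) {Ψ Ψ' : DimCtx} (σ : Subst Ψ' Ψ) :
    CEq T Γ ((starC Ψ).sub σ) (starC Ψ') := by
  rw [CubicalKan.starC_sub]
  exact .refl (isCCell_starC hs _)

theorem isCBdy_genDecl (hs : starDecl ∈ Γ) (a : X) : IsCBdy T Γ (genDecl a).bdy := by
  refine .snoc (.snoc .nil (isCCell_starC hs _) CBdy.forall_mem_nil) (isCCell_starC hs _) ?_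
  exact CBdy.forall_mem_snoc
    (.of_bot rfl ((isCCell_starC hs _).sub _) ((isCCell_starC hs _).sub _)) CBdy.forall_mem_nil

theorem isCBdy_sqDecl (hs : starDecl ∈ Γ) {a b c : X} (ha : genDecl a ∈ Γ) (hb : genDecl b ∈ Γ)
    (hc : genDecl c ∈ Γ) : IsCBdy T Γ (sqDecl a b c).bdy := by
  have hg : ∀ {a : X}, genDecl a ∈ Γ → IsCCell T Γ (genC (Ψ := .vars 1) a (.var (0 : Fin 1))) :=
    fun h => isCCell_genC h trivial
  have h₁ : IsCCell T Γ (starC (.vars 1)) := isCCell_starC hs _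
  refine .snoc (.snoc (.snoc (.snoc .nil (hg ha) CBdy.forall_mem_nil) (hg hc) ?_) h₁ ?_) (hg hb) ?_
  · exact CBdy.forall_mem_snoc (.of_bot rfl ((hg hc).sub _) ((hg ha).sub _)) CBdy.forall_mem_nil
  · refine CBdy.forall_mem_snoc ?_ (CBdy.forall_mem_snoc ?_ CBdy.forall_mem_nil)
    · exact (CEq.starC_sub hs _).trans (CEq.genC_const hc false).symm
    · exact (CEq.starC_sub hs _).trans (CEq.genC_const ha false).symm
  · refine CBdy.forall_mem_snoc ?_ (CBdy.forall_mem_snoc ?_ (CBdy.forall_mem_snoc ?_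
      CBdy.forall_mem_nil))
    · exact .of_bot rfl ((hg hb).sub _) (h₁.sub _)
    · exact (CEq.genC_const hb true).trans (CEq.genC_const hc true).symm
    · exact (CEq.genC_const hb false).trans (CEq.genC_const ha true).symm

/-- A context may be extended by a list of cells, with new and distinct names, whose boundaries
refer to the original context only. -/
theorem isCtx_append {V : Type u} {Γ : Ctx V} (hΓ : IsCtx T Γ) (L : Ctx V)
    (hL : (L.map Decl.name).Nodup) (hd : ∀ d ∈ L, ∀ d' ∈ Γ, d'.name ≠ d.name)
    (h : ∀ d ∈ L, ∀ Γ', Γ ⊆ Γ' → IsCBdy T Γ' d.bdy) : IsCtx T (L ++ Γ) := by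
  induction L with
  | nil => exact hΓ
  | cons d L ih =>
    simp only [List.map_cons, List.nodup_cons] at hL
    refine .cons (ih hL.2 (fun d hd' => hd d (.tail _ hd')) fun d hd' => h d (.tail _ hd')) ?_
      (h d (.head _) _ (List.subset_append_right _ _))
    intro d' hd'
    rcases List.mem_append.1 hd' with h' | h'
    · exact fun he => hL.1 (he ▸ List.mem_map_of_mem h')
    · exact hd d (.head _) d' h'

theorem GroupPresentation.isCtx_ctx [Fintype X] (P : GroupPresentation X) : IsCtx T P.ctx := by
  have hstar : IsCtx T [(starDecl : Decl (CellName X))] :=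
    .cons .nil (fun _ h => by cases h) .nil
  refine isCtx_append (isCtx_append hstar _ ?_ ?_ ?_) _ ?_ ?_ ?_
  · rw [List.map_map]
    exact (Finset.nodup_toList _).map fun a b h => by simpa [genDecl] using h
  · simp [genDecl, starDecl]
  · intro d hd Γ' hΓ
    obtain ⟨a, -, rfl⟩ := List.mem_map.1 hd
    exact isCBdy_genDecl (hΓ (by simp)) a
  · rw [List.map_map]
    refine (Finset.nodup_toList _).map fun p q h => ?_
    simpa [sqDecl, Prod.ext_iff] using h
  · simp only [List.mem_map, List.mem_append]
    rintro _ ⟨p, -, rfl⟩ d' (⟨a, -, rfl⟩ | h)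
    · simp [genDecl, sqDecl]
    · simp_all [starDecl, sqDecl]
  · intro d hd Γ' hΓ
    obtain ⟨p, -, rfl⟩ := List.mem_map.1 hd
    exact isCBdy_sqDecl (hΓ (by simp)) (hΓ (by simp)) (hΓ (by simp)) (hΓ (by simp))

end

/-! ### Squares of loops -/

section

variable {X : Type u} {T : ContortionTheory} {Γ : Ctx (CellName X)}

/-- The Kan cell `⋆` over a dimension context `Ψ`. -/
abbrev starT (Ψ : DimCtx) : Tm (CellName X) Ψ := .cont (starC Ψ)

/-- The Kan cell `â(i)` over `(i)`. -/
abbrev genT (a : X) : Tm (CellName X) (.vars 1) := .cont (genC (Ψ := .vars 1) a (.var (0 : Fin 1)))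

variable (T Γ) in
/-- Kan cells over `(i)` with both endpoints `⋆`. -/
structure IsLoop (p : Tm (CellName X) (.vars 1)) : Prop where
  isKan : IsKan T Γ p
  face : ∀ b, KanEq T Γ (p.face 0 b) (starT (.vars 0))

variable (T Γ) in
/-- `IsSquare r p S`: the Kan cell `S` over `(i, k)` has the faces `i = 0 ↪ ⋆`, `i = 1 ↪ r(k)` and
`k = b ↪ p b` for `b = 0, 1`. -/
structure IsSquare (r : Tm (CellName X) (.vars 1)) (p : Bool → Tm (CellName X) (.vars 1))
    (S : Tm (CellName X) (.vars 2)) : Prop where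
  isKan : IsKan T Γ S
  left : KanEq T Γ (S.face 0 false) (starT (.vars 1))
  right : KanEq T Γ (S.face 0 true) r
  base : ∀ b, KanEq T Γ (S.face 1 b) (p b)

theorem isKan_starT (hs : starDecl ∈ Γ) (Ψ : DimCtx) : IsKan T Γ (starT Ψ) :=
  .cont (isCCell_starC hs Ψ)

theorem KanEq.starT_sub (hs : starDecl ∈ Γ) {Ψ Ψ' : DimCtx} (σ : Subst Ψ' Ψ) :
    KanEq T Γ ((starT Ψ).sub σ) (starT Ψ') :=
  (KanEq.sub_cont (isCCell_starC hs Ψ)).trans (.cont (.starC_sub hs σ))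

theorem isLoop_starT (hs : starDecl ∈ Γ) : IsLoop T Γ (starT (.vars 1)) :=
  ⟨isKan_starT hs _, fun _ => .starT_sub hs _⟩

theorem isLoop_genT {a : X} (ha : genDecl a ∈ Γ) : IsLoop T Γ (genT a) :=
  have h : IsCCell T Γ (genC (Ψ := .vars 1) a (.var (0 : Fin 1))) := isCCell_genC ha trivial
  ⟨.cont h, fun b => (KanEq.sub_cont h).trans (.cont (CEq.genC_const ha b))⟩

/-- Equations between substitutions of variable lists can be checked variable by variable. -/
theorem Subst.ext_vars {Ψ : DimCtx} {n : ℕ} {σ τ : Subst Ψ (.vars n)}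
    (h : ∀ i : Fin n, σ.toFun i = τ.toFun i) : σ = τ :=
  Subst.ext (funext h)

/-- The sides `p b` of a square are loops, because its other two sides are. -/
theorem IsSquare.isLoop {r : Tm (CellName X) (.vars 1)} {p : Bool → Tm (CellName X) (.vars 1)}
    {S : Tm (CellName X) (.vars 2)} (hs : starDecl ∈ Γ) (h : IsSquare T Γ r p S)
    (hr : IsLoop T Γ r) (b : Bool) (hp : IsKan T Γ (p b)) : IsLoop T Γ (p b) := by
  refine ⟨hp, fun b' => ?_⟩
  have hc : (inclcon (Ψ := .vars 2) (.var (1 : Fin 2)) b).comp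
      (inclcon (Ψ := .vars 1) (.var (0 : Fin 1)) b') =
      (inclcon (Ψ := .vars 2) (.var (0 : Fin 2)) b').comp
      (inclcon (Ψ := .vars 1) (.var (0 : Fin 1)) b) :=
    Subst.ext_vars fun i => by fin_cases i <;> rfl
  refine (KanEq.sub_congr (h.base b)).symm.trans ((KanEq.sub_sub h.isKan hc).trans ?_)
  cases b'
  · exact (KanEq.sub_congr h.left).trans (.starT_sub hs _)
  · exact (KanEq.sub_congr h.right).trans (hr.face b)

/-- The open box in the dimensions `(i, l; k)` with base `U(i, l)` at `k = e` and with the faces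
`i = 0 ↪ ⋆`, `i = 1 ↪ R(l, k)` and `l = b ↪ S b (i, k)` has a composite, at `k = 1 - e`. -/
theorem IsSquare.comp (hs : starDecl ∈ Γ) (e : Bool) {R U : Tm (CellName X) (.vars 2)}
    {S : Bool → Tm (CellName X) (.vars 2)} {r : Bool → Tm (CellName X) (.vars 1)}
    {u : Tm (CellName X) (.vars 1)} {p : Bool → Bool → Tm (CellName X) (.vars 1)}
    (hR : IsKan T Γ R) (hRr : ∀ b, KanEq T Γ (R.face 0 b) (r b)) (hRu : KanEq T Γ (R.face 1 e) u)
    (hS : ∀ b, IsSquare T Γ (r b) (p b) (S b)) (hU : IsSquare T Γ u (fun b => p b e) U) :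
    ∃ V, IsSquare T Γ (R.face 1 !e) (fun b => p b !e) V := by
  -- The boundary of the box; its entries live over `(l; k)` or over `(i; k)`.
  let φ : KBdy (CellName X) 1 (.vars 2) := .snoc (.snoc (.snoc (.snoc .nil
    (.var (0 : Fin 2)) false (starT (.vars 2))) (.var (0 : Fin 2)) true R)
    (.var (1 : Fin 2)) false (S false)) (.var (1 : Fin 2)) true (S true)
  have hstar : IsKan T Γ (starT (.vars 2)) := isKan_starT hs _
  -- Adjacent faces agree: `S b` and `R` along `i = 1, l = b`.
  have hside (b : Bool) : KanEq T Γ ((S b).face 0 true) (R.face 0 b) :=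
    (hS b).right.trans (hRr b).symm
  -- Restricting the entry `S b` to `i = c`, and the entry on `i = c` to `l = b`, means taking the
  -- face of either square at its first variable.
  have hσ (b c : Bool) : Subst.extBy (inclcon (Ψ := .vars 1) ((Atom.var (Ψ := .vars 2)
      (0 : Fin 2)).sub (inclcon (Ψ := .vars 2) (.var (1 : Fin 2)) b)) c) 1 =
      inclcon (Ψ := .vars 2) (.var (0 : Fin 2)) c :=
    Subst.ext_vars fun j => by fin_cases j <;> rfl
  have hτ (b c : Bool) : Subst.extBy (Ψ' := .vars 0) (Ψ := .vars 1)
      ((inclcon (Ψ := .vars 2) (.var (1 : Fin 2)) b).con (.var (0 : Fin 2)) c) 1 =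
      inclcon (Ψ := .vars 2) (.var (0 : Fin 2)) b :=
    Subst.ext_vars fun j => by fin_cases j <;> rfl
  have hφ : IsKanBdy T Γ φ := by
    refine .snoc (.snoc (.snoc (.snoc .nil hstar KBdy.forall_mem_nil) hR ?_) (hS false).isKan ?_)
      (hS true).isKan ?_
    · exact KBdy.forall_mem_snoc (.of_bot rfl hR.sub hstar.sub) KBdy.forall_mem_nil
    · refine KBdy.forall_mem_snoc ?_ (KBdy.forall_mem_snoc ?_ KBdy.forall_mem_nil)
      · exact (KanEq.of_sub_eq (hS false).isKan (hσ false true)).trans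
          ((hside false).trans (KanEq.of_sub_eq hR (hτ false true)).symm)
      · exact (KanEq.of_sub_eq (hS false).isKan (hσ false false)).trans
          ((hS false).left.trans (KanEq.starT_sub hs _).symm)
    · refine KBdy.forall_mem_snoc ?_ (KBdy.forall_mem_snoc ?_ (KBdy.forall_mem_snoc ?_
        KBdy.forall_mem_nil))
      · exact .of_bot rfl (hS true).isKan.sub (hS false).isKan.sub
      · exact (KanEq.of_sub_eq (hS true).isKan (hσ true true)).trans
          ((hside true).trans (KanEq.of_sub_eq hR (hτ true true)).symm)
      · exact (KanEq.of_sub_eq (hS true).isKan (hσ true false)).trans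
          ((hS true).left.trans (KanEq.starT_sub hs _).symm)
  -- On each face of the box, instantiating `k` by `b` means taking its face `k = b`.
  have hinst (b c : Bool) (i : Fin 2) : Subst.instBy (Ψ := .vars 1)
      ((Atom.const b : Atom (.vars 2)).sub (inclcon (Ψ := .vars 2) (.var i) c)) 1 =
      inclcon (Ψ := .vars 2) (.var (1 : Fin 2)) b :=
    Subst.ext_vars fun j => by fin_cases j <;> rfl
  have hfill : IsKan T Γ (.fill e (.const !e) φ U) := by
    refine .fill hφ hU.isKan ?_
    refine KBdy.forall_mem_snoc ?_ (KBdy.forall_mem_snoc ?_ (KBdy.forall_mem_snoc ?_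
        (KBdy.forall_mem_snoc ?_ KBdy.forall_mem_nil)))
    · exact (hU.base true).trans (((hS true).base e).symm.trans
        (KanEq.of_sub_eq (hS true).isKan (hinst e true 1)).symm)
    · exact (hU.base false).trans (((hS false).base e).symm.trans
        (KanEq.of_sub_eq (hS false).isKan (hinst e false 1)).symm)
    · exact hU.right.trans (hRu.symm.trans (KanEq.of_sub_eq hR (hinst e true 0)).symm)
    · exact hU.left.trans (KanEq.starT_sub hs _).symm
  refine ⟨_, hfill, ?_, ?_, ?_⟩
  · exact (KanEq.fill_side hfill (.there (.there (.there .here)))).trans (.starT_sub hs _)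
  · exact (KanEq.fill_side hfill (.there (.there .here))).trans (.of_sub_eq hR (hinst (!e) true 0))
  · rintro (_ | _)
    · exact (KanEq.fill_side hfill (.there .here)).trans
        ((KanEq.of_sub_eq (hS false).isKan (hinst (!e) false 1)).trans ((hS false).base _))
    · exact (KanEq.fill_side hfill .here).trans
        ((KanEq.of_sub_eq (hS true).isKan (hinst (!e) true 1)).trans ((hS true).base _))

end

/-! ### Sliding loops along squares -/

section

variable {X : Type u} {T : ContortionTheory} {Γ : Ctx (CellName X)}

variable (T Γ) in
/-- There is a square over `(i, k)` with faces `i = 0 ↪ ⋆`, `i = 1 ↪ r(k)`, `k = 0 ↪ p(i)` and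
`k = 1 ↪ q(i)`: the path `p` slides to `q` when its terminal point moves along `r`. For `r = ⋆`
this is homotopy of loops. -/
def Slides (r p q : Tm (CellName X) (.vars 1)) : Prop :=
  ∃ S, IsSquare T Γ r (fun b => bif b then q else p) S

/-- A loop becomes constant when an endpoint is substituted for its variable, here in two steps. -/
theorem IsLoop.sub_sub_const (hs : starDecl ∈ Γ) {p : Tm (CellName X) (.vars 1)}
    (hp : IsLoop T Γ p) {n m : ℕ} {σ : Subst (.vars m) (.vars 1)} {τ : Subst (.vars n) (.vars m)}
    (b : Bool) (h : (σ.comp τ).toFun (0 : Fin 1) = .const b) :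
    KanEq T Γ ((p.sub σ).sub τ) (starT (.vars n)) := by
  let ρ : Subst (.vars n) (.vars 0) := ⟨fun i => Fin.elim0 i, fun h => DimCtx.noConfusion h⟩
  have hc : σ.comp τ = (inclcon (Ψ := .vars 1) (.var (0 : Fin 1)) b).comp ρ :=
    Subst.ext_vars fun i => by
      obtain rfl : i = 0 := Subsingleton.elim _ _
      exact h
  exact (KanEq.sub_sub hp.isKan hc).trans ((KanEq.sub_congr (hp.face b)).trans (.starT_sub hs ρ))

theorem Slides.refl (hs : starDecl ∈ Γ) {p : Tm (CellName X) (.vars 1)} (hp : IsLoop T Γ p) :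
    Slides T Γ (starT (.vars 1)) p p := by
  have h (b : Bool) : KanEq T Γ ((p.sub (Subst.wk (.vars 1))).face 0 b) (starT (.vars 1)) :=
    hp.sub_sub_const hs b rfl
  refine ⟨_, .sub hp.isKan, h false, h true, fun b => ?_⟩
  rw [Bool.cond_self]
  exact KanEq.sub_sub_id hp.isKan (Subst.ext_vars fun i => by fin_cases i; rfl)

/-- The composition of an open box whose face over `i = 1` is degenerate. -/
theorem IsSquare.comp_const (hs : starDecl ∈ Γ) (e : Bool) {r : Tm (CellName X) (.vars 1)}
    {p : Bool → Bool → Tm (CellName X) (.vars 1)} (hr : IsLoop T Γ r)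
    {S : Bool → Tm (CellName X) (.vars 2)} (hS : ∀ b, IsSquare T Γ r (p b) (S b))
    {U : Tm (CellName X) (.vars 2)}
    (hU : IsSquare T Γ (starT (.vars 1)) (fun b => p b e) U) :
    ∃ V, IsSquare T Γ (starT (.vars 1)) (fun b => p b !e) V := by
  let σ : Subst (.vars 2) (.vars 1) := ⟨fun _ => .var (1 : Fin 2), fun h => DimCtx.noConfusion h⟩
  have h (b : Bool) : KanEq T Γ ((r.sub σ).face 1 b) (starT (.vars 1)) :=
    hr.sub_sub_const hs b rfl
  obtain ⟨V, hV⟩ := IsSquare.comp hs e (R := r.sub σ) (r := fun _ => r) (.sub hr.isKan)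
    (fun b => KanEq.sub_sub_id hr.isKan (Subst.ext_vars fun i => by fin_cases i; rfl))
    (h e) hS hU
  exact ⟨V, hV.isKan, hV.left, hV.right.trans (h _), hV.base⟩

/-- Sliding along the same loop `r` preserves homotopy. -/
theorem Slides.forward (hs : starDecl ∈ Γ) {r p q p' q' : Tm (CellName X) (.vars 1)}
    (hr : IsLoop T Γ r) (h : Slides T Γ r p q) (h' : Slides T Γ r p' q')
    (hp : Slides T Γ (starT (.vars 1)) p p') : Slides T Γ (starT (.vars 1)) q q' := by
  obtain ⟨S, hS⟩ := h
  obtain ⟨S', hS'⟩ := h'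
  obtain ⟨U, hU⟩ := hp
  obtain ⟨V, hV⟩ := IsSquare.comp_const hs false
    (p := fun b c => bif b then (bif c then q' else p') else (bif c then q else p)) hr
    (S := fun b => bif b then S' else S) (by rintro (_ | _) <;> assumption) hU
  exact ⟨V, hV⟩

/-- Sliding along the same loop `r` reflects homotopy. -/
theorem Slides.backward (hs : starDecl ∈ Γ) {r p q p' q' : Tm (CellName X) (.vars 1)}
    (hr : IsLoop T Γ r) (h : Slides T Γ r p q) (h' : Slides T Γ r p' q')
    (hq : Slides T Γ (starT (.vars 1)) q q') : Slides T Γ (starT (.vars 1)) p p' := by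
  obtain ⟨S, hS⟩ := h
  obtain ⟨S', hS'⟩ := h'
  obtain ⟨U, hU⟩ := hq
  obtain ⟨V, hV⟩ := IsSquare.comp_const hs true
    (p := fun b c => bif b then (bif c then q' else p') else (bif c then q else p)) hr
    (S := fun b => bif b then S' else S) (by rintro (_ | _) <;> assumption) hU
  exact ⟨V, hV⟩

theorem Slides.symm (hs : starDecl ∈ Γ) {p q : Tm (CellName X) (.vars 1)} (hp : IsLoop T Γ p)
    (h : Slides T Γ (starT (.vars 1)) p q) : Slides T Γ (starT (.vars 1)) q p :=
  h.forward hs (isLoop_starT hs) (.refl hs hp) (.refl hs hp)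

theorem Slides.trans (hs : starDecl ∈ Γ) {p q q' : Tm (CellName X) (.vars 1)} (hp : IsLoop T Γ p)
    (hq : IsLoop T Γ q) (h : Slides T Γ (starT (.vars 1)) p q)
    (h' : Slides T Γ (starT (.vars 1)) q q') : Slides T Γ (starT (.vars 1)) p q' :=
  (h.symm hs hp).forward hs (isLoop_starT hs) h' (.refl hs hq)

/-- The square of an equation `a b c⁻¹ = 1` closes the box with faces `â` and `ĉ`. -/
theorem Slides.of_sqDecl (hs : starDecl ∈ Γ) {a b c : X} (h : sqDecl a b c ∈ Γ)
    {p q q' : Tm (CellName X) (.vars 1)} (hp : IsLoop T Γ p) (ha : Slides T Γ (genT a) p q)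
    (hc : Slides T Γ (genT c) p q') : Slides T Γ (genT b) q q' := by
  obtain ⟨S, hS⟩ := ha
  obtain ⟨S', hS'⟩ := hc
  obtain ⟨U, hU⟩ := Slides.refl hs hp
  -- The face `R(l, k) = s_{a,b,c}(k, l)`, with the variables exchanged: the box is filled in the
  -- direction `j` of the square, from `⋆` at `j = 0` to `b̂` at `j = 1`.
  let R : CCell (CellName X) (.vars 2) := sqC a b c (.var (1 : Fin 2)) (.var (0 : Fin 2))
  have hR : IsCCell T Γ R := isCCell_sqC h trivial trivial
  have hface (i : Fin 2) (e : Bool) : KanEq T Γ ((Tm.cont R).face i e)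
      (.cont (sqC (Ψ := .vars 1) a b c
        (((inclcon (Ψ := .vars 2) (.var i) e).toFun (1 : Fin 2)).toTerm)
        (((inclcon (Ψ := .vars 2) (.var i) e).toFun (0 : Fin 2)).toTerm))) := by
    have := KanEq.sub_cont (σ := inclcon (Ψ := .vars 2) (.var i) e) hR
    rwa [CCell.sub, sqC_act] at this
  have h₀ : KanEq T Γ ((Tm.cont R).face 0 false) (genT a) :=
    (hface 0 false).trans (.cont (CEq.sqC_bdy (i := 1) (e := false) h
      (Atom.inLang_toTerm _) (Atom.inLang_toTerm _) (.there (.there (.there .here))) rfl rfl))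
  have h₁ : KanEq T Γ ((Tm.cont R).face 0 true) (genT c) :=
    (hface 0 true).trans (.cont (CEq.sqC_bdy (i := 1) (e := true) h
      (Atom.inLang_toTerm _) (Atom.inLang_toTerm _) (.there (.there .here)) rfl rfl))
  have h₂ : KanEq T Γ ((Tm.cont R).face 1 true) (genT b) :=
    (hface 1 true).trans (.cont (CEq.sqC_bdy (i := 0) (e := true) h
      (Atom.inLang_toTerm _) (Atom.inLang_toTerm _) .here rfl rfl))
  have h₃ : KanEq T Γ ((Tm.cont R).face 1 false) (starT (.vars 1)) :=
    (hface 1 false).trans (.cont (CEq.sqC_bdy (i := 0) (e := false) h (Atom.inLang_toTerm _)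
      (Atom.inLang_toTerm _) (.there .here) rfl (starC_act _)))
  obtain ⟨V, hV⟩ := IsSquare.comp hs false
    (r := fun b => bif b then genT c else genT a)
    (p := fun b e => bif b then (bif e then q' else p) else (bif e then q else p))
    (S := fun b => bif b then S' else S) (.cont hR) (by rintro (_ | _) <;> assumption) h₃
    (by rintro (_ | _) <;> assumption) hU
  exact ⟨V, hV.isKan, hV.left, hV.right.trans h₂, hV.base⟩

/-! ### Appending generators -/

theorem isSquare_appendFill (hs : starDecl ∈ Γ) {a : X} (ha : genDecl a ∈ Γ) (e : Bool)
    {p : Tm (CellName X) (.vars 1)} (hp : IsLoop T Γ p) :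
    IsSquare T Γ (genT a) (fun b => if b = e then append e a p else p) (appendFill e a p) := by
  have hg : IsKan T Γ (.cont (genC (Ψ := .vars 2) a (.var (1 : Fin 2)))) :=
    .cont (isCCell_genC ha trivial)
  have hstar : IsKan T Γ (starT (.vars 2)) := isKan_starT hs _
  have hwk (b : Bool) : KanEq T Γ ((p.sub (Subst.wk (.vars 1))).face 0 b) (starT (.vars 1)) :=
    hp.sub_sub_const hs b rfl
  have hgen {Ψ : DimCtx} (σ : Subst Ψ (.vars 2)) : KanEq T Γ
      ((Tm.cont (genC (Ψ := .vars 2) a (.var (1 : Fin 2)))).sub σ)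
      (.cont (genC a (σ.toFun (1 : Fin 2)).toTerm)) :=
    .sub_cont (isCCell_genC ha trivial)
  have hfill : IsKan T Γ (appendFill e a p) := by
    refine .fill (.snoc (.snoc .nil hstar KBdy.forall_mem_nil) hg ?_) (.sub hp.isKan) ?_
    · exact KBdy.forall_mem_snoc (.of_bot rfl hg.sub hstar.sub) KBdy.forall_mem_nil
    · refine KBdy.forall_mem_snoc ?_ (KBdy.forall_mem_snoc ?_ KBdy.forall_mem_nil)
      · exact (hwk true).trans ((hgen _).trans (.cont (CEq.genC_const ha _))).symm
      · exact (hwk false).trans (KanEq.starT_sub hs _).symm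
  refine ⟨hfill, ?_, ?_, fun b => ?_⟩
  · exact (KanEq.fill_side hfill (.there .here)).trans (.starT_sub hs _)
  · exact (KanEq.fill_side hfill .here).trans (hgen _)
  · split_ifs with hb
    · subst hb
      exact .of_sub_eq hfill (Subst.ext_vars fun i => by fin_cases i <;> rfl)
    · obtain rfl : b = !e := Bool.eq_not_of_ne hb
      exact (KanEq.fill_base hfill).trans
        (KanEq.sub_sub_id hp.isKan (Subst.ext_vars fun i => by fin_cases i; rfl))

theorem IsLoop.append (hs : starDecl ∈ Γ) {a : X} (ha : genDecl a ∈ Γ) (e : Bool)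
    {p : Tm (CellName X) (.vars 1)} (hp : IsLoop T Γ p) : IsLoop T Γ (append e a p) := by
  have h := isSquare_appendFill hs ha e hp
  simpa using h.isLoop hs (isLoop_genT ha) e (by simpa using .sub h.isKan)

theorem slides_append_true (hs : starDecl ∈ Γ) {a : X} (ha : genDecl a ∈ Γ)
    {p : Tm (CellName X) (.vars 1)} (hp : IsLoop T Γ p) :
    Slides T Γ (genT a) p (append true a p) :=
  ⟨_, by simpa [Bool.cond_eq_ite] using isSquare_appendFill hs ha true hp⟩

/-- An inverse letter is appended by filling from `1` to `0`, so the filler starts at the result. -/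
theorem slides_append_false (hs : starDecl ∈ Γ) {a : X} (ha : genDecl a ∈ Γ)
    {p : Tm (CellName X) (.vars 1)} (hp : IsLoop T Γ p) :
    Slides T Γ (genT a) (append false a p) p :=
  ⟨appendFill false a p, by
    convert isSquare_appendFill hs ha false hp using 2 with b
    cases b <;> rfl⟩

theorem Slides.append (hs : starDecl ∈ Γ) {a : X} (ha : genDecl a ∈ Γ) (e : Bool)
    {p q : Tm (CellName X) (.vars 1)} (hp : IsLoop T Γ p) (hq : IsLoop T Γ q)
    (h : Slides T Γ (starT (.vars 1)) p q) :
    Slides T Γ (starT (.vars 1)) (append e a p) (append e a q) := by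
  cases e
  · exact (slides_append_false hs ha hp).backward hs (isLoop_genT ha)
      (slides_append_false hs ha hq) h
  · exact (slides_append_true hs ha hp).forward hs (isLoop_genT ha) (slides_append_true hs ha hq) h

/-- The fillers of the two letters are squares that share the side `â` and one of the ends. -/
theorem slides_append_not_append (hs : starDecl ∈ Γ) {a : X} (ha : genDecl a ∈ Γ) (e : Bool)
    {p : Tm (CellName X) (.vars 1)} (hp : IsLoop T Γ p) :
    Slides T Γ (starT (.vars 1)) (append (!e) a (append e a p)) p := by
  have hq := hp.append hs ha e
  cases e
  · exact (slides_append_true hs ha hq).forward hs (isLoop_genT ha) (slides_append_false hs ha hp)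
      (.refl hs hq)
  · exact (slides_append_false hs ha hq).backward hs (isLoop_genT ha) (slides_append_true hs ha hp)
      (.refl hs hq)

/-- Both loops are the result of sliding the path with `a` appended along `b`: one by the filler
that defines `▷ b`, the other by the square `s_{a,b,c}`. -/
theorem slides_append_append (hs : starDecl ∈ Γ) {a b c : X} (ha : genDecl a ∈ Γ)
    (hb : genDecl b ∈ Γ) (hc : genDecl c ∈ Γ) (h : sqDecl a b c ∈ Γ)
    {p : Tm (CellName X) (.vars 1)} (hp : IsLoop T Γ p) :
    Slides T Γ (starT (.vars 1)) (append true b (append true a p)) (append true c p) :=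
  have hq := hp.append hs ha true
  (slides_append_true hs hb hq).forward hs (isLoop_genT hb)
    (.of_sqDecl hs h hp (slides_append_true hs ha hp) (slides_append_true hs hc hp)) (.refl hs hq)

end

/-! ### The presented group acts on homotopy classes of paths of words -/

section

variable {X : Type u}

theorem wordPath_append_singleton (w : Word X) (x : X × Bool) :
    wordPath (w ++ [x]) = append x.2 x.1 (wordPath w) := by
  simp [wordPath]

variable [Fintype X] (P : GroupPresentation X) (T : ContortionTheory)

namespace GroupPresentation

theorem starDecl_mem_ctx : starDecl ∈ P.ctx := P.mem_ctx.2 (.inr (.inr rfl))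

theorem genDecl_mem_ctx (a : X) : genDecl a ∈ P.ctx := P.mem_ctx.2 (.inr (.inl ⟨a, rfl⟩))

theorem isLoop_wordPath (w : Word X) : IsLoop T P.ctx (wordPath w) := by
  induction w using List.reverseRecOn with
  | nil => exact isLoop_starT P.starDecl_mem_ctx
  | append_singleton w x ih =>
    rw [wordPath_append_singleton]
    exact ih.append P.starDecl_mem_ctx (P.genDecl_mem_ctx x.1) x.2

/-- Words up to homotopy of the loops that encode them. -/
def homotopySetoid : Setoid (Word X) where
  r v w := Slides T P.ctx (starT (.vars 1)) (wordPath v) (wordPath w)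
  iseqv :=
    ⟨fun v => .refl P.starDecl_mem_ctx (P.isLoop_wordPath T v),
      fun h => h.symm P.starDecl_mem_ctx (P.isLoop_wordPath T _),
      fun h h' => h.trans P.starDecl_mem_ctx (P.isLoop_wordPath T _) (P.isLoop_wordPath T _) h'⟩

/-- Appending a letter, on homotopy classes of words. -/
def appendLetter (x : X × Bool) (q : Quotient (P.homotopySetoid T)) :
    Quotient (P.homotopySetoid T) :=
  q.map (sa := P.homotopySetoid T) (sb := P.homotopySetoid T) (fun w => w ++ [x]) fun v w h => by
    change Slides T P.ctx _ (wordPath (v ++ [x])) (wordPath (w ++ [x]))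
    rw [wordPath_append_singleton, wordPath_append_singleton]
    exact h.append P.starDecl_mem_ctx (P.genDecl_mem_ctx _) _ (P.isLoop_wordPath T _)
      (P.isLoop_wordPath T _)

theorem appendLetter_mk (x : X × Bool) (w : Word X) :
    P.appendLetter T x (Quotient.mk _ w) = Quotient.mk _ (w ++ [x]) :=
  rfl

theorem appendLetter_not_appendLetter (a : X) (e : Bool) (q : Quotient (P.homotopySetoid T)) :
    P.appendLetter T (a, !e) (P.appendLetter T (a, e) q) = q := by
  induction q using Quotient.ind with
  | _ w =>
    refine Quotient.sound ?_
    change Slides T P.ctx _ (wordPath (w ++ [(a, e)] ++ [(a, !e)])) (wordPath w)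
    rw [wordPath_append_singleton, wordPath_append_singleton]
    exact slides_append_not_append P.starDecl_mem_ctx (P.genDecl_mem_ctx a) e
      (P.isLoop_wordPath T w)

theorem appendLetter_triangle {a b c : X} (h : triangle a b c ∈ P.rels)
    (q : Quotient (P.homotopySetoid T)) :
    P.appendLetter T (b, true) (P.appendLetter T (a, true) q) = P.appendLetter T (c, true) q := by
  induction q using Quotient.ind with
  | _ w =>
    refine Quotient.sound ?_
    change Slides T P.ctx _ (wordPath (w ++ [(a, true)] ++ [(b, true)]))
      (wordPath (w ++ [(c, true)]))
    rw [wordPath_append_singleton, wordPath_append_singleton, wordPath_append_singleton]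
    exact slides_append_append P.starDecl_mem_ctx (P.genDecl_mem_ctx a) (P.genDecl_mem_ctx b)
      (P.genDecl_mem_ctx c) (P.mem_ctx.2 (.inl ⟨a, b, c, h, rfl⟩)) (P.isLoop_wordPath T w)

/-- A generator permutes the homotopy classes of words, by appending. -/
def appendPerm (a : X) : Equiv.Perm (Quotient (P.homotopySetoid T)) where
  toFun := P.appendLetter T (a, true)
  invFun := P.appendLetter T (a, false)
  left_inv := P.appendLetter_not_appendLetter T a true
  right_inv := P.appendLetter_not_appendLetter T a false

/-- The free group acts on homotopy classes letter by letter. The first letter acts first,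
whence the opposite group. -/
theorem unop_lift_appendPerm (w : Word X) (q : Quotient (P.homotopySetoid T)) :
    (FreeGroup.lift (fun a => MulOpposite.op (P.appendPerm T a)) (FreeGroup.mk w)).unop q =
      w.foldl (fun q x => P.appendLetter T x q) q := by
  rw [FreeGroup.lift_mk]
  induction w generalizing q with
  | nil => rfl
  | cons x w ih =>
    rw [List.map_cons, List.prod_cons, MulOpposite.unop_mul, Equiv.Perm.mul_apply, ih,
      List.foldl_cons]
    obtain ⟨a, _ | _⟩ := x <;> rfl

theorem foldl_appendLetter (v w : Word X) :
    w.foldl (fun q x => P.appendLetter T x q) (Quotient.mk (P.homotopySetoid T) v) =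
      Quotient.mk _ (v ++ w) := by
  induction w generalizing v with
  | nil => simp
  | cons x w ih => rw [List.foldl_cons, appendLetter_mk, ih, List.append_assoc]; rfl

variable {P}

/-- Words that represent the same group element are encoded by homotopic loops. -/
theorem slides_wordPath (hP : P.IsConvenient) {v w : Word X} (h : P.eval v = P.eval w) :
    Slides T P.ctx (starT (.vars 1)) (wordPath v) (wordPath w) := by
  let f : X → (Equiv.Perm (Quotient (P.homotopySetoid T)))ᵐᵒᵖ :=
    fun a => MulOpposite.op (P.appendPerm T a)
  have hf : ∀ r ∈ {g : FreeGroup X | ∃ w ∈ P.rels, g = FreeGroup.mk w},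
      FreeGroup.lift f r = 1 := by
    rintro _ ⟨w, hw, rfl⟩
    obtain ⟨a, b, c, rfl⟩ := hP.rels_triangle w hw
    refine MulOpposite.unop_injective (Equiv.ext fun q => ?_)
    rw [unop_lift_appendPerm]
    simp only [triangle, List.foldl_cons, List.foldl_nil]
    rw [P.appendLetter_triangle T hw]
    exact P.appendLetter_not_appendLetter T c true q
  have key : FreeGroup.lift f (FreeGroup.mk v) = FreeGroup.lift f (FreeGroup.mk w) :=
    congrArg (PresentedGroup.toGroup hf) h
  -- The class of `v` is the image of the class of the empty word under the action of `v`.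
  have := congrArg (fun g => g.unop (Quotient.mk (P.homotopySetoid T) [])) key
  simp only [f, unop_lift_appendPerm, foldl_appendLetter, List.nil_append] at this
  exact Quotient.exact this

end GroupPresentation

theorem isKanBdy_wordBdy (v w : Word X) : IsKanBdy T P.ctx (wordBdy v w) := by
  have hs := P.starDecl_mem_ctx
  have hstar : IsKan T P.ctx (starT (.vars 1)) := isKan_starT hs _
  have hloop (u : Word X) (b : Bool) {Ψ : DimCtx} (σ : Subst (.vars 0) Ψ) :
      KanEq T P.ctx ((wordPath u).face 0 b) ((starT Ψ).sub σ) :=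
    ((P.isLoop_wordPath T u).face b).trans (KanEq.starT_sub hs σ).symm
  have hv := (P.isLoop_wordPath T v).isKan
  have hw := (P.isLoop_wordPath T w).isKan
  refine .snoc (.snoc (.snoc (.snoc .nil hstar KBdy.forall_mem_nil) hstar ?_) hv ?_) hw ?_
  · exact KBdy.forall_mem_snoc (.of_bot rfl hstar.sub hstar.sub) KBdy.forall_mem_nil
  · exact KBdy.forall_mem_snoc (hloop v true _)
      (KBdy.forall_mem_snoc (hloop v false _) KBdy.forall_mem_nil)
  · exact KBdy.forall_mem_snoc (.of_bot rfl hw.sub hv.sub) (KBdy.forall_mem_snoc (hloop w true _)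
      (KBdy.forall_mem_snoc (hloop w false _) KBdy.forall_mem_nil))

theorem Slides.exists_hasKanBdy {v w : Word X}
    (h : Slides T P.ctx (starT (.vars 1)) (wordPath v) (wordPath w)) :
    ∃ t : Tm (CellName X) (.vars 2), HasKanBdy T P.ctx t (wordBdy v w) := by
  obtain ⟨S, hS⟩ := h
  exact ⟨S, P.isCtx_ctx, isKanBdy_wordBdy P T v w, hS.isKan,
    KBdy.forall_mem_snoc (hS.base true) (KBdy.forall_mem_snoc (hS.base false)
      (KBdy.forall_mem_snoc hS.right (KBdy.forall_mem_snoc hS.left KBdy.forall_mem_nil)))⟩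

end

end CubicalKan

theorem mainTheorem2 {X : Type u} [Fintype X] (P : CubicalKan.GroupPresentation X)
    (hP : P.IsConvenient) (T : CubicalKan.ContortionTheory) (v w : CubicalKan.Word X) :
    (∃ t : CubicalKan.Tm (CubicalKan.CellName X) (.vars 2),
      CubicalKan.HasKanBdy T P.ctx t (CubicalKan.wordBdy v w)) ↔ P.eval v = P.eval w :=
  ⟨fun ⟨_, ht⟩ => CubicalKan.eval_eq_of_hasKanBdy P ht,
    fun h => CubicalKan.Slides.exists_hasKanBdy P T
      (CubicalKan.GroupPresentation.slides_wordPath T hP h)⟩
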